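/- Let $X$ and $Y$ be complex Hilbert spaces and let $(T(t))_{t\ge 0}$ be a $C_0$-semigroup on $X$ with generator $A$. Equip $D(A)$ with the graph norm $\|x\|_A=\|x\|+\|Ax\|$, let $\mathcal L(D(A),Y)$ be the space of bounded linear operators from $D(A)$ to $Y$, and write $R(\lambda,A)=(\lambda I-A)^{-1}$ for $\lambda$ in the resolvent set of $A$. Assume that $(T(t))_{t\ge0}$ is polynomially stable, that is, $\sup_{t\ge 0}\|T(t)\|<\infty$ and there is $\alpha>0$ with $\|T(t)(I-A)^{-1}\|=O(t^{-1/\alpha})$ as $t\to\infty$. Let $C\in\mathcal L(D(A),Y)$ satisfy the following two conditions. (a) $C$ is $L^2$-finite-time admissible for $A$: there are $M_1>0$ and $t_1>0$ such that $\int_0^{t_1}\|CT(t)x\|^2\,dt\le M_1\|x\|^2$ for all $x\in D(A)$. (b) $C$ satisfies the strong $2$-Weiss condition for $A$: there is $\alpha'>0$ such that $C(-A)^{\alpha'}$, with domain $\{x\in D((-A)^{\alpha'}) : (-A)^{\alpha'}x\in D(A)\}$, extends to an operator $\widetilde C\in\mathcal L(D(A),Y)$, and this extension satisfies the $2$-Weiss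 condition, that is, there is $K>0$ such that $\|\widetilde C R(\lambda,A)\|\le K/(\operatorname{Re}\lambda)^{1/2}$ for all $\lambda\in\mathbb C$ with $\operatorname{Re}\lambda>0$. Here $(-A)^{\alpha'}$ is the usual fractional power of the sectorial operator $-A$. Then $C$ is $L^2$-infinite-time admissible for $A$: there is $M>0$ such that $$\int_0^\infty\|CT(t)x\|^2\,dt\le M\|x\|^2\qquad\text{for all }x\in D(A).$$ -/

import Mathlib

open MeasureTheory Filter Topology
open scoped NNReal ENNReal

namespace SemigroupTheory

/-- A `C₀`-semigroup of bounded linear operators on the complex normed space `X`. -/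
structure C0Semigroup (X : Type*) [NormedAddCommGroup X] [NormedSpace ℂ X] where
  toFun : ℝ≥0 → X →L[ℂ] X
  map_zero : toFun 0 = ContinuousLinearMap.id ℂ X
  map_add : ∀ s t : ℝ≥0, toFun (s + t) = (toFun s).comp (toFun t)
  continuous_orbit : ∀ x : X, Continuous fun t => toFun t x

instance {X : Type*} [NormedAddCommGroup X] [NormedSpace ℂ X] :
    CoeFun (C0Semigroup X) fun _ => ℝ≥0 → X →L[ℂ] X :=
  ⟨C0Semigroup.toFun⟩

/-- The composite `g f` of unbounded operators, on its natural domain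
`{x ∈ D(f) : f x ∈ D(g)}`. -/
noncomputable def natComp {E F G : Type*} [AddCommGroup E] [Module ℂ E] [AddCommGroup F]
    [Module ℂ F] [AddCommGroup G] [Module ℂ G] (g : F →ₗ.[ℂ] G) (f : E →ₗ.[ℂ] F) :
    E →ₗ.[ℂ] G :=
  g.comp (f.domRestrict ((g.domain.comap f.toFun).map f.domain.subtype)) (by
    rintro ⟨x, hx⟩
    obtain ⟨y, hy, hyx⟩ := hx.1
    have h : f.domRestrict _ ⟨x, hx⟩ = f y := LinearPMap.domRestrict_apply hyx.symm
    rw [h]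
    exact hy)

theorem mem_natComp_domain {E F G : Type*} [AddCommGroup E] [Module ℂ E] [AddCommGroup F]
    [Module ℂ F] [AddCommGroup G] [Module ℂ G] (g : F →ₗ.[ℂ] G) (f : E →ₗ.[ℂ] F) (x : E) :
    x ∈ (natComp g f).domain ↔ ∃ hx : x ∈ f.domain, f ⟨x, hx⟩ ∈ g.domain := by
  constructor
  · rintro ⟨⟨y, hy, rfl⟩, hx⟩
    exact ⟨y.2, hy⟩
  · rintro ⟨hx, h⟩
    exact ⟨⟨⟨x, hx⟩, h, rfl⟩, hx⟩

theorem natComp_apply {E F G : Type*} [AddCommGroup E] [Module ℂ E] [AddCommGroup F]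
    [Module ℂ F] [AddCommGroup G] [Module ℂ G] (g : F →ₗ.[ℂ] G) (f : E →ₗ.[ℂ] F)
    (x : (natComp g f).domain) (hx : (x : E) ∈ f.domain) (h : f ⟨x, hx⟩ ∈ g.domain) :
    natComp g f x = g ⟨f ⟨x, hx⟩, h⟩ := rfl

/-- The `k`-th power of an unbounded operator, on its natural domain; the `0`-th power is the
identity of `X`. -/
noncomputable def opPow {X : Type*} [AddCommGroup X] [Module ℂ X] (B : X →ₗ.[ℂ] X) :
    ℕ → (X →ₗ.[ℂ] X)
  | 0 => LinearMap.id.toPMap ⊤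
  | k + 1 => natComp B (opPow B k)

section Generator

variable {X : Type*} [NormedAddCommGroup X] [NormedSpace ℂ X]

/-- The graph of the generator: all `(x, y)` such that `(T(h) x - x) / h → y` as `h → 0+`. -/
noncomputable def C0Semigroup.generatorGraph (T : C0Semigroup X) : Submodule ℂ (X × X) where
  carrier := {p | Tendsto (fun h : ℝ≥0 => ((h : ℝ) : ℂ)⁻¹ • (T h p.1 - p.1)) (𝓝[>] 0) (𝓝 p.2)}
  zero_mem' := by simp
  add_mem' := by
    intro p q hp hq
    refine (Tendsto.add hp hq).congr fun h => ?_
    simp only [Prod.fst_add, _root_.map_add, ← smul_add]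
    congr 1
    abel
  smul_mem' := by
    intro c p hp
    refine (Tendsto.const_smul hp c).congr fun h => ?_
    simp only [Prod.smul_fst, map_smul, ← smul_sub]
    rw [smul_comm]

/-- The generator `A` of a `C₀`-semigroup, an unbounded operator on `X`. -/
noncomputable def C0Semigroup.generator (T : C0Semigroup X) : X →ₗ.[ℂ] X :=
  T.generatorGraph.toLinearPMap

theorem C0Semigroup.generator_graph (T : C0Semigroup X) :
    T.generator.graph = T.generatorGraph := by
  refine Submodule.toLinearPMap_graph_eq _ ?_
  rintro ⟨x, y⟩ h rfl
  have h' : Tendsto (fun h : ℝ≥0 => ((h : ℝ) : ℂ)⁻¹ • (T h (0 : X) - 0)) (𝓝[>] 0) (𝓝 y) := h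
  simp only [_root_.map_zero, sub_zero, smul_zero] at h'
  exact tendsto_nhds_unique h' tendsto_const_nhds

/-- `D(A)` is invariant under the semigroup. -/
theorem C0Semigroup.map_mem_domain (T : C0Semigroup X) (t : ℝ≥0) {x : X}
    (hx : x ∈ T.generator.domain) : T t x ∈ T.generator.domain := by
  obtain ⟨y, hy⟩ := LinearPMap.mem_domain_iff.1 hx
  refine LinearPMap.mem_domain_iff.2 ⟨T t y, ?_⟩
  rw [C0Semigroup.generator_graph] at hy ⊢
  refine (((T t).continuous.tendsto y).comp hy).congr fun h => ?_
  have hcomm : T t (T h x) = T h (T t x) := by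
    have h1 := congrArg (fun S : X →L[ℂ] X => S x) (T.map_add t h)
    have h2 := congrArg (fun S : X →L[ℂ] X => S x) (T.map_add h t)
    rw [add_comm h t] at h2
    exact h1.symm.trans h2
  simp only [Function.comp_apply, map_smul, map_sub, hcomm]

/-- The restriction of `T(t)` to `D(A)`. -/
noncomputable def C0Semigroup.onDomain (T : C0Semigroup X) (t : ℝ≥0) :
    T.generator.domain →ₗ[ℂ] T.generator.domain :=
  (T t).toLinearMap.restrict fun _ hx => T.map_mem_domain t hx

end Generator

section Operators

variable {X Y : Type*} [NormedAddCommGroup X] [NormedSpace ℂ X]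
  [NormedAddCommGroup Y] [NormedSpace ℂ Y]

/-- The operator `z I - A` on `D(A)`. -/
noncomputable def shift (A : X →ₗ.[ℂ] X) (z : ℂ) : A.domain →ₗ[ℂ] X :=
  z • A.domain.subtype - A.toFun

/-- The resolvent set `ϱ(A)`: all `z` such that `z I - A : D(A) → X` is bijective with bounded
inverse. -/
def opResolventSet (A : X →ₗ.[ℂ] X) : Set ℂ :=
  {z | Function.Bijective (shift A z) ∧ ∃ c : ℝ, ∀ x : A.domain, ‖(x : X)‖ ≤ c * ‖shift A z x‖}

open Classical in
/-- The resolvent `R(z, A) = (z I - A)⁻¹` as a map onto `D(A)`, for `z ∈ ϱ(A)` (and `0`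
outside `ϱ(A)`). -/
noncomputable def opResolvent (A : X →ₗ.[ℂ] X) (z : ℂ) : X →ₗ[ℂ] A.domain :=
  if h : z ∈ opResolventSet A then (LinearEquiv.ofBijective (shift A z) h.1).symm.toLinearMap else 0

theorem exists_bound_resolvent (A : X →ₗ.[ℂ] X) (z : ℂ) :
    ∃ c : ℝ, ∀ x : X, ‖(A.domain.subtype ∘ₗ opResolvent A z) x‖ ≤ c * ‖x‖ := by
  by_cases h : z ∈ opResolventSet A
  · obtain ⟨c, hc⟩ := h.2
    refine ⟨c, fun x => ?_⟩
    have hx : shift A z (opResolvent A z x) = x := by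
      rw [opResolvent, dif_pos h]
      exact LinearEquiv.apply_symm_apply (LinearEquiv.ofBijective (shift A z) h.1) x
    have h2 := hc (opResolvent A z x)
    rw [hx] at h2
    exact h2
  · exact ⟨0, fun x => by simp [opResolvent, h]⟩

/-- The resolvent `R(z, A)` as a bounded operator on `X`. -/
noncomputable def resolventCLM (A : X →ₗ.[ℂ] X) (z : ℂ) : X →L[ℂ] X :=
  (A.domain.subtype ∘ₗ opResolvent A z).mkContinuousOfExistsBound (exists_bound_resolvent A z)

/-- `C ∈ L(D(A), Y)`: the linear map `C` is bounded for the graph norm `‖x‖ + ‖A x‖` on `D(A)`. -/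
def IsGraphBounded (A : X →ₗ.[ℂ] X) (C : A.domain →ₗ[ℂ] Y) : Prop :=
  ∃ c : ℝ, ∀ x : A.domain, ‖C x‖ ≤ c * (‖(x : X)‖ + ‖A x‖)

/-- The integrand `s ^ (b - 1) (s I - A)⁻¹ (-A) x` of Balakrishnan's formula. -/
noncomputable def balakrishnanIntegrand (A : X →ₗ.[ℂ] X) (b : ℝ) (x : A.domain) (s : ℝ) : X :=
  s ^ (b - 1) • (opResolvent A (s : ℂ) (-A x) : X)

theorem balakrishnanIntegrand_add (A : X →ₗ.[ℂ] X) (b : ℝ) (x y : A.domain) :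
    balakrishnanIntegrand A b (x + y) =
      balakrishnanIntegrand A b x + balakrishnanIntegrand A b y := by
  funext s
  simp only [balakrishnanIntegrand, Pi.add_apply, ← smul_add, ← Submodule.coe_add,
    ← _root_.map_add, LinearPMap.map_add, neg_add]

theorem balakrishnanIntegrand_smul (A : X →ₗ.[ℂ] X) (b : ℝ) (c : ℂ) (x : A.domain) :
    balakrishnanIntegrand A b (c • x) = c • balakrishnanIntegrand A b x := by
  funext s
  simp only [balakrishnanIntegrand, Pi.smul_apply, LinearPMap.map_smul, ← smul_neg,
    _root_.map_smul, Submodule.coe_smul]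
  rw [smul_comm]

/-- Balakrishnan's operator of order `b ∈ (0, 1)`,
`x ↦ (sin (π b) / π) ∫₀^∞ s ^ (b - 1) (s I - A)⁻¹ (-A) x ds` for `x ∈ D(A)`.
If `A` generates a bounded semigroup, then the integral converges absolutely for each `x ∈ D(A)`,
so that the domain is all of `D(A)`. -/
noncomputable def balakrishnan (A : X →ₗ.[ℂ] X) (b : ℝ) : X →ₗ.[ℂ] X where
  domain :=
    { carrier := {x | ∃ hx : x ∈ A.domain,
        IntegrableOn (balakrishnanIntegrand A b ⟨x, hx⟩) (Set.Ioi 0)}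
      zero_mem' := by
        refine ⟨A.domain.zero_mem, ?_⟩
        have h := balakrishnanIntegrand_smul A b 0 0
        rw [zero_smul, zero_smul] at h
        exact h ▸ integrableOn_zero
      add_mem' := by
        rintro x y ⟨hx, hx'⟩ ⟨hy, hy'⟩
        exact ⟨A.domain.add_mem hx hy,
          (balakrishnanIntegrand_add A b ⟨x, hx⟩ ⟨y, hy⟩) ▸ Integrable.add hx' hy'⟩
      smul_mem' := by
        rintro c x ⟨hx, hx'⟩
        exact ⟨A.domain.smul_mem c hx,
          (balakrishnanIntegrand_smul A b c ⟨x, hx⟩) ▸ Integrable.smul c hx'⟩ }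
  toFun :=
    { toFun := fun x => (Real.sin (Real.pi * b) / Real.pi) •
        ∫ s in Set.Ioi (0 : ℝ), balakrishnanIntegrand A b ⟨x, x.2.fst⟩ s
      map_add' := by
        rintro ⟨x, hx, hx'⟩ ⟨y, hy, hy'⟩
        have h := balakrishnanIntegrand_add A b ⟨x, hx⟩ ⟨y, hy⟩
        have h2 := integral_add hx' hy'
        rw [← smul_add, ← h2]
        exact congrArg (fun f : ℝ → X => (Real.sin (Real.pi * b) / Real.pi) •
          ∫ s in Set.Ioi (0 : ℝ), f s) h
      map_smul' := by
        rintro c ⟨x, hx, hx'⟩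
        have h := balakrishnanIntegrand_smul A b c ⟨x, hx⟩
        have h2 := integral_smul (μ := volume.restrict (Set.Ioi (0 : ℝ))) c
          (balakrishnanIntegrand A b ⟨x, hx⟩)
        rw [RingHom.id_apply, smul_comm c, ← h2]
        exact congrArg (fun f : ℝ → X => (Real.sin (Real.pi * b) / Real.pi) •
          ∫ s in Set.Ioi (0 : ℝ), f s) h }

/-- The fractional power `(-A) ^ a` for `a > 0`, where `A` generates a bounded semigroup:
write `a = k + b` with `k` a natural number and `0 ≤ b < 1`; then
`(-A) ^ a = (-A) ^ k (-A) ^ b`, where `(-A) ^ 0` is the identity and, for `0 < b < 1`, `(-A) ^ b`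
is the closure of Balakrishnan's operator on `D(A)`. -/
noncomputable def negFracPow (A : X →ₗ.[ℂ] X) (a : ℝ) : X →ₗ.[ℂ] X :=
  natComp (opPow (-A) ⌊a⌋₊)
    (if Int.fract a = 0 then LinearMap.id.toPMap ⊤ else (balakrishnan A (Int.fract a)).closure)

/-- The `p`-Weiss condition: `‖C R(z, A)‖ ≤ K / (Re z) ^ (1 - 1/p)` on the open right half-plane,
with `1/p = 0` for `p = ∞`. -/
def WeissCondition (p : ℝ≥0∞) (A : X →ₗ.[ℂ] X) (C : A.domain →ₗ[ℂ] Y) : Prop :=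
  ∃ K : ℝ, 0 < K ∧ ∀ z : ℂ, 0 < z.re → ∀ x : X,
    ‖C (opResolvent A z x)‖ ≤ K / z.re ^ (1 - p.toReal⁻¹) * ‖x‖

/-- The strong `2`-Weiss condition: for some `a > 0`, the operator `C (-A) ^ a` (on its natural
domain) extends to an operator in `L(D(A), Y)` which satisfies the `2`-Weiss condition. -/
def StrongWeissCondition (A : X →ₗ.[ℂ] X) (C : A.domain →ₗ[ℂ] Y) : Prop :=
  ∃ a : ℝ, 0 < a ∧ ∃ C' : A.domain →ₗ[ℂ] Y, IsGraphBounded A C' ∧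
    natComp ⟨A.domain, C⟩ (negFracPow A a) ≤ ⟨A.domain, C'⟩ ∧ WeissCondition 2 A C'

/-- Polynomial stability: the semigroup is bounded and, for some `a > 0`,
`‖T(t) (I - A)⁻¹‖ = O(t ^ (-1/a))` as `t → ∞`. -/
def C0Semigroup.PolynomiallyStable (T : C0Semigroup X) : Prop :=
  (∃ M : ℝ, ∀ t, ‖T t‖ ≤ M) ∧
  ∃ a : ℝ, 0 < a ∧
    (fun t : ℝ≥0 => ‖(T t).comp (resolventCLM T.generator 1)‖) =O[atTop]
      fun t : ℝ≥0 => (t : ℝ) ^ (-1 / a)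

/-- `L²`-finite-time admissibility of `C`. -/
def FiniteTimeAdmissible (T : C0Semigroup X) (C : T.generator.domain →ₗ[ℂ] Y) : Prop :=
  ∃ M t₁ : ℝ, 0 < M ∧ 0 < t₁ ∧ ∀ x : T.generator.domain,
    ∫⁻ t in Set.Ioo 0 t₁, ‖C (T.onDomain t.toNNReal x)‖ₑ ^ 2 ≤ ENNReal.ofReal (M * ‖(x : X)‖ ^ 2)

/-- `L²`-infinite-time admissibility of `C`. -/
def InfiniteTimeAdmissible (T : C0Semigroup X) (C : T.generator.domain →ₗ[ℂ] Y) : Prop :=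
  ∃ M : ℝ, 0 < M ∧ ∀ x : T.generator.domain,
    ∫⁻ t in Set.Ioi (0 : ℝ), ‖C (T.onDomain t.toNNReal x)‖ₑ ^ 2 ≤
      ENNReal.ofReal (M * ‖(x : X)‖ ^ 2)

end Operators

end SemigroupTheory

/-! Write `C'` for the extension of `C (-A)^r`. The strong Weiss condition lets `C` be read as `C'
(-A)^(-r)`: the 2-Weiss condition on `C'` is nearly admissible, and polynomial stability makes `T(t)
(-A)^(-r)` decay. The decay repairs what the Weiss condition misses.

Weiss condition to block energy. The transform of `(e^(-ξt) - e^(-2ξt)) C' T(t) x` is `C'` applied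
to a difference of resolvents on two vertical lines, that is, `ξ C' R(z₁) R(z₂) x` with `Re z₁ = ξ`
and `Re z₂ = 2ξ`. The Weiss condition costs `ξ^(-1/2)` for the first resolvent, and Plancherel
applied to the damped orbit costs `M / (2 ξ^(1/2))` in `L²` for the second. The powers of `ξ` cancel
exactly. Taking `ξ = 1/τ` bounds the energy of `C' T(t) x` on `(τ, 3τ]` by `N ‖x‖²`, uniformly in
`τ` (`exists_lintegral_output_le`). Summing this over dyadic blocks would diverge.

Decay. Polynomial stability gives `0 ∈ ϱ(A)` and `‖T(t) A⁻¹‖ ≤ c t^(-a)`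
(`PolynomiallyStable.exists_decay`). A bounded right inverse `G` of `(-A)^r` on `D(A)` is built from
powers of `(-A)⁻¹` and the integral `∫ s^(-b) R(s, A) ds`, and interpolation gives `‖T(t) G‖ ≤ c'
t^(-a')` for some `a' > 0` (`exists_right_inverse_negFracPow`).

Conclusion. Since `C x = C' G x` on `D(A)`, the output on `(2τ, 4τ]` is the `C'`-output on `(τ, 3τ]`
started from `T(τ) G x`, so its energy is `O(τ^(-2a')) ‖x‖²`. This is summable over `τ = 2^n t₁ /
3`; finite-time admissibility covers the remaining times. -/

open MeasureTheory Filter Topology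
open scoped NNReal ENNReal

/-! ### Plancherel's theorem for Hilbert-space-valued functions. -/

section Plancherel

open scoped FourierTransform SchwartzMap ContDiff

variable {F : Type*} [NormedAddCommGroup F] [InnerProductSpace ℂ F] [CompleteSpace F]

/-- Both sides are locally integrable, so it suffices to test against smooth compactly supported
functions. The `L²` transform is characterised as a tempered distribution by moving `𝓕` onto the
test function, and for integrable `f` Fubini moves it back. -/
theorem MeasureTheory.MemLp.coeFn_fourier_toLp {f : ℝ → F} (h1 : Integrable f)
    (h2 : MemLp f 2) : ((𝓕 (h2.toLp f) : Lp F 2 (volume : Measure ℝ)) : ℝ → F) =ᵐ[volume] 𝓕 f := by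
  have hcont : Continuous (𝓕 f) :=
    VectorFourier.fourierIntegral_continuous Real.continuous_fourierChar
      (by exact continuous_inner) h1
  refine ae_eq_of_integral_contDiff_smul_eq
    ((Lp.memLp _).locallyIntegrable (by norm_num)) hcont.locallyIntegrable fun g hg hgs => ?_
  have hgs' : HasCompactSupport (Complex.ofRealCLM ∘ g) := hgs.comp_left rfl
  have hg' : ContDiff ℝ ∞ (Complex.ofRealCLM ∘ g) := by fun_prop
  let φ : 𝓢(ℝ, ℂ) := hgs'.toSchwartzMap hg'
  have hφ : ∀ x, φ x = (g x : ℂ) := fun x => rfl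
  have key := congrArg (fun S : 𝓢'(ℝ, F) => S φ)
    (Lp.fourier_toTemperedDistribution_eq (h2.toLp f))
  simp only [TemperedDistribution.fourier_apply, Lp.toTemperedDistribution_apply] at key
  have h3 : ∀ u : ℝ → F, ∫ x, g x • u x = ∫ x, φ x • u x := fun u =>
    integral_congr_ae (Eventually.of_forall fun x => by simp [hφ])
  rw [h3, h3, ← key]
  have h4 : ∫ x, (𝓕 φ) x • (h2.toLp f : ℝ → F) x = ∫ x, (𝓕 φ) x • f x :=
    integral_congr_ae (by filter_upwards [h2.coeFn_toLp] with x hx; rw [hx])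
  rw [h4, SchwartzMap.fourier_coe]
  simpa using! VectorFourier.integral_bilin_fourierIntegral_eq_flip (.lsmul ℂ ℂ)
    (L := innerₗ ℝ) Real.continuous_fourierChar continuous_inner φ.integrable h1

theorem MeasureTheory.MemLp.eLpNorm_fourier {f : ℝ → F} (h1 : Integrable f)
    (h2 : MemLp f 2) : eLpNorm (𝓕 f) 2 volume = eLpNorm f 2 volume := by
  rw [← eLpNorm_congr_ae (h2.coeFn_fourier_toLp h1), ← eLpNorm_congr_ae h2.coeFn_toLp,
    ← Lp.enorm_def, ← Lp.enorm_def, ← ofReal_norm, ← ofReal_norm, Lp.norm_fourier_eq]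

/-- Plancherel's theorem for integrable, square-integrable functions on the line. -/
theorem MeasureTheory.MemLp.lintegral_enorm_fourier_sq {f : ℝ → F} (h1 : Integrable f)
    (h2 : MemLp f 2) : ∫⁻ x, ‖𝓕 f x‖ₑ ^ 2 = ∫⁻ x, ‖f x‖ₑ ^ 2 := by
  have h := h2.eLpNorm_fourier h1
  rw [eLpNorm_eq_lintegral_rpow_enorm_toReal (by norm_num) (by norm_num),
    eLpNorm_eq_lintegral_rpow_enorm_toReal (by norm_num) (by norm_num)] at h
  simpa using ENNReal.rpow_left_injective (by norm_num) h

end Plancherel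
-- Resolvent identities and the graph of the generator.
namespace SemigroupTheory

section Resolvent

variable {X : Type*} [NormedAddCommGroup X] [NormedSpace ℂ X] {A : X →ₗ.[ℂ] X} {z w : ℂ}

theorem coe_opResolvent (A : X →ₗ.[ℂ] X) (z : ℂ) (x : X) :
    (opResolvent A z x : X) = resolventCLM A z x := rfl

theorem shift_apply (A : X →ₗ.[ℂ] X) (z : ℂ) (x : A.domain) :
    shift A z x = z • (x : X) - A x := rfl

theorem shift_opResolvent (hz : z ∈ opResolventSet A) (x : X) :
    shift A z (opResolvent A z x) = x := by
  rw [opResolvent, dif_pos hz]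
  exact LinearEquiv.apply_symm_apply (LinearEquiv.ofBijective (shift A z) hz.1) x

theorem opResolvent_shift (hz : z ∈ opResolventSet A) (x : A.domain) :
    opResolvent A z (shift A z x) = x :=
  hz.1.1 (shift_opResolvent hz _)

theorem apply_opResolvent (hz : z ∈ opResolventSet A) (x : X) :
    A (opResolvent A z x) = z • resolventCLM A z x - x := by
  have h := shift_opResolvent hz x
  rw [shift_apply, coe_opResolvent] at h
  exact eq_sub_of_add_eq' (sub_eq_iff_eq_add.1 h).symm

theorem opResolvent_sub_opResolvent (hz : z ∈ opResolventSet A) (hw : w ∈ opResolventSet A)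
    (x : X) : opResolvent A z x - opResolvent A w x =
      (w - z) • opResolvent A z (resolventCLM A w x) := by
  apply hz.1.1
  rw [map_sub, map_smul, shift_opResolvent hz, shift_opResolvent hz, shift_apply,
    apply_opResolvent hw, coe_opResolvent, sub_smul]
  abel

theorem resolventCLM_sub_resolventCLM (hz : z ∈ opResolventSet A) (hw : w ∈ opResolventSet A)
    (x : X) : resolventCLM A z x - resolventCLM A w x =
      (w - z) • resolventCLM A z (resolventCLM A w x) :=
  congrArg Subtype.val (opResolvent_sub_opResolvent hz hw x)

theorem resolventCLM_comm (hz : z ∈ opResolventSet A) (hw : w ∈ opResolventSet A)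
    (x : X) : resolventCLM A z (resolventCLM A w x) = resolventCLM A w (resolventCLM A z x) := by
  rcases eq_or_ne z w with rfl | h
  · rfl
  · have h1 := resolventCLM_sub_resolventCLM hz hw x
    have h2 := resolventCLM_sub_resolventCLM hw hz x
    rw [← neg_sub, h1, ← neg_smul, neg_sub] at h2
    exact smul_right_injective X (sub_ne_zero.2 h) h2

end Resolvent

section Generator

variable {X : Type*} [NormedAddCommGroup X] [NormedSpace ℂ X]

theorem tendsto_nnreal_slope {φ : ℝ → X} {y : X} (h : HasDerivAt φ y 0) :
    Tendsto (fun h : ℝ≥0 => ((h : ℝ) : ℂ)⁻¹ • (φ h - φ 0)) (𝓝[>] 0) (𝓝 y) := by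
  have h1 := hasDerivAt_iff_tendsto_slope.1 h
  have h2 : Tendsto (fun h : ℝ≥0 => (h : ℝ)) (𝓝[>] 0) (𝓝[≠] 0) := by
    refine tendsto_nhdsWithin_iff.2 ⟨?_, ?_⟩
    · exact (NNReal.continuous_coe.tendsto 0).mono_left nhdsWithin_le_nhds
    · filter_upwards [self_mem_nhdsWithin] with t ht
      exact NNReal.coe_ne_zero.2 (ne_of_gt ht)
  refine (h1.comp h2).congr fun t => ?_
  simp only [Function.comp_apply, slope_def_module, sub_zero]
  rw [← Complex.ofReal_inv, Complex.coe_smul]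

namespace C0Semigroup

variable (T : C0Semigroup X)

theorem apply_add (s t : ℝ≥0) (x : X) : T (s + t) x = T s (T t x) :=
  congrArg (fun S : X →L[ℂ] X => S x) (T.map_add s t)

theorem apply_comm (s t : ℝ≥0) (x : X) : T s (T t x) = T t (T s x) := by
  rw [← apply_add, add_comm, apply_add]

theorem apply_zero (x : X) : T 0 x = x :=
  congrArg (fun S : X →L[ℂ] X => S x) T.map_zero

theorem continuous_orbit_real (x : X) : Continuous fun t : ℝ => T t.toNNReal x :=
  (T.continuous_orbit x).comp continuous_real_toNNReal

theorem mem_graph_coe (x : T.generator.domain) :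
    ((x : X), T.generator x) ∈ T.generatorGraph := by
  rw [← generator_graph]
  exact T.generator.mem_graph x

theorem exists_of_mem_graph {x y : X} (h : (x, y) ∈ T.generatorGraph) :
    ∃ hx : x ∈ T.generator.domain, T.generator ⟨x, hx⟩ = y := by
  rw [← generator_graph, LinearPMap.mem_graph_iff] at h
  obtain ⟨⟨u, hu⟩, rfl, h2⟩ := h
  exact ⟨hu, h2⟩

theorem graph_unique {x y y' : X} (h : (x, y) ∈ T.generatorGraph)
    (h' : (x, y') ∈ T.generatorGraph) : y = y' := by
  obtain ⟨hx, rfl⟩ := T.exists_of_mem_graph h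
  obtain ⟨hx', rfl⟩ := T.exists_of_mem_graph h'
  rfl

/-- A bounded operator which commutes with the semigroup commutes with its generator. -/
theorem map_mem_graph {S : X →L[ℂ] X} (hS : ∀ t x, S (T t x) = T t (S x)) {x y : X}
    (h : (x, y) ∈ T.generatorGraph) : (S x, S y) ∈ T.generatorGraph := by
  refine ((S.continuous.tendsto y).comp h).congr fun t => ?_
  simp only [Function.comp_apply, map_smul, map_sub, hS]

theorem mem_graph_of_hasDerivAt {φ : ℝ → X} {x y : X} (h : HasDerivAt φ y 0)
    (h0 : φ 0 = x) (hφ : ∀ t : ℝ≥0, φ t = T t x) : (x, y) ∈ T.generatorGraph := by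
  refine (tendsto_nnreal_slope h).congr fun t => ?_
  rw [hφ, h0]

/-- A bounded operator which commutes with the semigroup and is a right inverse of `z - A` is the
resolvent. -/
theorem resolvent_eq_of_right_inverse {z : ℂ} {U : X →L[ℂ] X}
    (hU : ∀ t x, U (T t x) = T t (U x)) (h : ∀ x, (U x, z • U x - x) ∈ T.generatorGraph) :
    z ∈ opResolventSet T.generator ∧ resolventCLM T.generator z = U := by
  have hright : ∀ x, ∃ hx : U x ∈ T.generator.domain, shift T.generator z ⟨U x, hx⟩ = x := by
    intro x
    obtain ⟨hx, hx'⟩ := T.exists_of_mem_graph (h x)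
    refine ⟨hx, ?_⟩
    rw [shift_apply, hx']
    abel
  have hleft : ∀ x : T.generator.domain, U (shift T.generator z x) = x := by
    intro x
    -- Commuting with the semigroup, `U` also commutes with `A`; hence the right inverse is a left
    -- inverse.
    have h1 := T.graph_unique (h x) (T.map_mem_graph hU (T.mem_graph_coe x))
    rw [shift_apply, map_sub, map_smul, ← h1]
    abel
  have hz : z ∈ opResolventSet T.generator := by
    refine ⟨⟨fun x y hxy => ?_, fun x => ?_⟩, ‖U‖, fun x => ?_⟩
    · rw [← Subtype.coe_inj, ← hleft, ← hleft, hxy]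
    · obtain ⟨hx, hx'⟩ := hright x
      exact ⟨_, hx'⟩
    · conv_lhs => rw [← hleft x]
      exact U.le_opNorm _
  refine ⟨hz, ContinuousLinearMap.ext fun x => ?_⟩
  rw [← coe_opResolvent, ← hleft, shift_opResolvent hz]

end C0Semigroup

end Generator

end SemigroupTheory
-- The resolvent as a Laplace transform.
namespace SemigroupTheory

theorem setIntegral_Ioi_comp_add_right {E : Type*} [NormedAddCommGroup E] [NormedSpace ℝ E]
    (f : ℝ → E) (a h : ℝ) :
    ∫ t in Set.Ioi a, f (t + h) = ∫ t in Set.Ioi (a + h), f t := by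
  have := (measurePreserving_add_right volume h).setIntegral_preimage_emb
    (measurableEmbedding_addRight h) f (Set.Ioi (a + h))
  simpa using this

namespace C0Semigroup

variable {X : Type*} [NormedAddCommGroup X] [NormedSpace ℂ X] (T : C0Semigroup X)

theorem norm_exp_smul_orbit_le {M : ℝ} (hM : ∀ t, ‖T t‖ ≤ M) (z : ℂ) (x : X) (t : ℝ) :
    ‖Complex.exp (-z * t) • T t.toNNReal x‖ ≤ Real.exp (-z.re * t) * (M * ‖x‖) := by
  rw [norm_smul, Complex.norm_exp]
  simp only [Complex.mul_re, Complex.neg_re, Complex.ofReal_re, Complex.ofReal_im, mul_zero,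
    sub_zero]
  gcongr
  exact (T t.toNNReal).le_of_opNorm_le (hM _) x

theorem continuous_exp_smul_orbit (z : ℂ) (x : X) :
    Continuous fun t : ℝ => Complex.exp (-z * t) • T t.toNNReal x := by
  have := T.continuous_orbit_real x
  fun_prop

theorem integrableOn_exp_smul_orbit {M : ℝ} (hM : ∀ t, ‖T t‖ ≤ M) {z : ℂ} (hz : 0 < z.re)
    (x : X) :
    IntegrableOn (fun t : ℝ => Complex.exp (-z * t) • T t.toNNReal x) (Set.Ioi 0) := by
  refine Integrable.mono' ((integrableOn_exp_mul_Ioi (neg_lt_zero.2 hz) 0).mul_const (M * ‖x‖))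
    (T.continuous_exp_smul_orbit z x).aestronglyMeasurable ?_
  exact Eventually.of_forall (T.norm_exp_smul_orbit_le hM z x)

theorem norm_integral_exp_smul_orbit_le {M : ℝ} (hM : ∀ t, ‖T t‖ ≤ M) {z : ℂ} (hz : 0 < z.re)
    (x : X) :
    ‖∫ t in Set.Ioi (0 : ℝ), Complex.exp (-z * t) • T t.toNNReal x‖ ≤ M / z.re * ‖x‖ := by
  refine (norm_integral_le_of_norm_le
    ((integrableOn_exp_mul_Ioi (neg_lt_zero.2 hz) 0).mul_const (M * ‖x‖))
    (Eventually.of_forall (T.norm_exp_smul_orbit_le hM z x))).trans_eq ?_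
  rw [integral_mul_const, integral_exp_mul_Ioi (neg_lt_zero.2 hz)]
  simp
  ring

/-- The Laplace transform of the orbits of a bounded semigroup. -/
noncomputable def laplace {M : ℝ} (hM : ∀ t, ‖T t‖ ≤ M) {z : ℂ} (hz : 0 < z.re) : X →L[ℂ] X :=
  LinearMap.mkContinuous
    { toFun := fun x => ∫ t in Set.Ioi (0 : ℝ), Complex.exp (-z * t) • T t.toNNReal x
      map_add' := fun x y => by
        simp only [_root_.map_add, smul_add]
        exact integral_add (T.integrableOn_exp_smul_orbit hM hz x)
          (T.integrableOn_exp_smul_orbit hM hz y)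
      map_smul' := fun c x => by
        simp only [map_smul, RingHom.id_apply, ← integral_smul]
        simp only [smul_comm c] }
    (M / z.re) (T.norm_integral_exp_smul_orbit_le hM hz)

theorem laplace_apply {M : ℝ} (hM : ∀ t, ‖T t‖ ≤ M) {z : ℂ} (hz : 0 < z.re) (x : X) :
    T.laplace hM hz x =
      ∫ t in Set.Ioi (0 : ℝ), Complex.exp (-z * t) • T t.toNNReal x := rfl

variable [CompleteSpace X] {M : ℝ} (hM : ∀ t, ‖T t‖ ≤ M) {z : ℂ} (hz : 0 < z.re)

theorem laplace_comm (t : ℝ≥0) (x : X) :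
    T.laplace hM hz (T t x) = T t (T.laplace hM hz x) := by
  rw [laplace_apply, laplace_apply,
    ← (T t).integral_comp_comm (T.integrableOn_exp_smul_orbit hM hz x)]
  simp only [map_smul, T.apply_comm t]

/-- Translation by `h` turns the Laplace integral into its tail. The right-hand side makes sense for
every real `h`, so the generator can be read off from an ordinary derivative at `0`. -/
theorem apply_laplace (h : ℝ≥0) (x : X) : T h (T.laplace hM hz x) =
    Complex.exp (z * (h : ℝ)) • (T.laplace hM hz x -
      ∫ t in (0 : ℝ)..h, Complex.exp (-z * t) • T t.toNNReal x) := by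
  rw [← intervalIntegral.integral_Ioi_sub_Ioi (T.integrableOn_exp_smul_orbit hM hz x)
      h.coe_nonneg, ← laplace_apply T hM hz,
    sub_sub_cancel, laplace_apply,
    ← (T h).integral_comp_comm (T.integrableOn_exp_smul_orbit hM hz x), ← integral_smul]
  have h1 := setIntegral_Ioi_comp_add_right
    (fun t : ℝ => Complex.exp (z * (h : ℝ)) • Complex.exp (-z * t) • T t.toNNReal x) 0 h
  rw [zero_add] at h1
  rw [← h1]
  refine setIntegral_congr_fun measurableSet_Ioi fun t ht => ?_
  have h2 : (t + h).toNNReal = h + t.toNNReal := by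
    rw [Real.toNNReal_add (le_of_lt ht) h.coe_nonneg, Real.toNNReal_coe, add_comm]
  simp only [map_smul]
  rw [h2, apply_add, smul_smul, ← Complex.exp_add]
  congr 2
  push_cast
  ring

theorem laplace_mem_graph (x : X) :
    (T.laplace hM hz x, z • T.laplace hM hz x - x) ∈ T.generatorGraph := by
  have h1 : HasDerivAt (fun h : ℝ => ∫ t in (0 : ℝ)..h, Complex.exp (-z * t) • T t.toNNReal x)
      x 0 := by
    have := (T.continuous_exp_smul_orbit z x).integral_hasStrictDerivAt 0 0
    simpa [apply_zero] using this.hasDerivAt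
  have h2 : HasDerivAt (fun h : ℝ => Complex.exp (z * h)) z 0 := by
    have h3 : HasDerivAt (fun h : ℝ => z * (h : ℂ)) z 0 := by
      simpa using (Complex.ofRealCLM.hasDerivAt (x := 0)).const_mul z
    simpa using h3.cexp
  have h4 := h2.smul (h1.const_sub (T.laplace hM hz x))
  refine T.mem_graph_of_hasDerivAt (x := T.laplace hM hz x)
    (y := z • T.laplace hM hz x - x) (φ := fun h : ℝ => Complex.exp (z * h) •
    (T.laplace hM hz x - ∫ t in (0 : ℝ)..h, Complex.exp (-z * t) • T t.toNNReal x)) ?_ ?_ ?_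
  · convert! h4 using 1
    simp
    abel
  · simp
  · exact fun t => (T.apply_laplace hM hz t x).symm

include hM hz

theorem mem_resolventSet_of_re_pos : z ∈ opResolventSet T.generator :=
  (T.resolvent_eq_of_right_inverse (T.laplace_comm hM hz) (T.laplace_mem_graph hM hz)).1

theorem resolventCLM_eq_laplace : resolventCLM T.generator z = T.laplace hM hz :=
  (T.resolvent_eq_of_right_inverse (T.laplace_comm hM hz) (T.laplace_mem_graph hM hz)).2

theorem resolventCLM_apply_eq_integral (x : X) : resolventCLM T.generator z x =
    ∫ t in Set.Ioi (0 : ℝ), Complex.exp (-z * t) • T t.toNNReal x := by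
  rw [T.resolventCLM_eq_laplace hM hz, laplace_apply]

theorem norm_resolventCLM_apply_le (x : X) : ‖resolventCLM T.generator z x‖ ≤ M / z.re * ‖x‖ := by
  rw [T.resolventCLM_apply_eq_integral hM hz]
  exact T.norm_integral_exp_smul_orbit_le hM hz x

end C0Semigroup

end SemigroupTheory
-- Orbit integrals and invertibility of the generator.
namespace SemigroupTheory

namespace C0Semigroup

variable {X : Type*} [NormedAddCommGroup X] [NormedSpace ℂ X] (T : C0Semigroup X)

/-- A bounded operator which commutes with the semigroup commutes with the resolvents. -/
theorem map_resolventCLM_comm {S : X →L[ℂ] X} (hS : ∀ t x, S (T t x) = T t (S x)) {z : ℂ}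
    (hz : z ∈ opResolventSet T.generator) (x : X) :
    S (resolventCLM T.generator z x) = resolventCLM T.generator z (S x) := by
  have h := T.map_mem_graph hS (T.mem_graph_coe (opResolvent T.generator z x))
  obtain ⟨h1, h2⟩ := T.exists_of_mem_graph h
  have h3 : (⟨_, h1⟩ : T.generator.domain) = opResolvent T.generator z (S x) := by
    apply hz.1.1
    rw [shift_opResolvent hz, shift_apply, h2, apply_opResolvent hz]
    simp [coe_opResolvent]
  exact congrArg Subtype.val h3

theorem resolventCLM_apply_comm {z : ℂ} (hz : z ∈ opResolventSet T.generator) (t : ℝ≥0) (x : X) :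
    T t (resolventCLM T.generator z x) = resolventCLM T.generator z (T t x) :=
  T.map_resolventCLM_comm (T.apply_comm t) hz x

theorem intervalIntegrable_orbit (x : X) (a b : ℝ) :
    IntervalIntegrable (fun s : ℝ => T s.toNNReal x) volume a b :=
  (T.continuous_orbit_real x).intervalIntegrable a b

/-- The operator `x ↦ ∫₀ᵗ T(s) x ds`. -/
noncomputable def orbitIntegral {M : ℝ} (hM : ∀ t, ‖T t‖ ≤ M) (t : ℝ≥0) : X →L[ℂ] X :=
  LinearMap.mkContinuous
    { toFun := fun x => ∫ s in (0 : ℝ)..t, T s.toNNReal x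
      map_add' := fun x y => by
        simp only [_root_.map_add]
        exact intervalIntegral.integral_add (T.intervalIntegrable_orbit x _ _)
          (T.intervalIntegrable_orbit y _ _)
      map_smul' := fun c x => by
        simp only [map_smul, RingHom.id_apply, ← intervalIntegral.integral_smul] }
    (M * |(t : ℝ) - 0|) (fun x => by
      rw [mul_right_comm]
      exact intervalIntegral.norm_integral_le_of_norm_le_const fun s _ =>
        (T s.toNNReal).le_of_opNorm_le (hM _) x)

variable {M : ℝ} (hM : ∀ t, ‖T t‖ ≤ M)

theorem orbitIntegral_apply (t : ℝ≥0) (x : X) :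
    T.orbitIntegral hM t x = ∫ s in (0 : ℝ)..t, T s.toNNReal x := rfl

variable [CompleteSpace X]

theorem apply_orbitIntegral (h t : ℝ≥0) (x : X) :
    T h (T.orbitIntegral hM t x) = T.orbitIntegral hM t (T h x) := by
  rw [orbitIntegral_apply, orbitIntegral_apply,
    ← (T h).intervalIntegral_comp_comm (T.intervalIntegrable_orbit x _ _)]
  simp only [T.apply_comm h]

theorem orbitIntegral_mem_graph (t : ℝ≥0) (x : X) :
    (T.orbitIntegral hM t x, T t x - x) ∈ T.generatorGraph := by
  have hc := T.continuous_orbit_real x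
  have h1 : HasDerivAt (fun h : ℝ => ∫ s in (0 : ℝ)..h, T s.toNNReal x) x 0 := by
    simpa [apply_zero] using (hc.integral_hasStrictDerivAt 0 0).hasDerivAt
  have h2 : HasDerivAt (fun h : ℝ => ∫ s in (0 : ℝ)..(t + h), T s.toNNReal x) (T t x) 0 := by
    have := (hc.integral_hasStrictDerivAt 0 ((t : ℝ) + 0)).hasDerivAt
    simpa using this.comp_const_add (t : ℝ) 0
  refine T.mem_graph_of_hasDerivAt (x := T.orbitIntegral hM t x) (h2.sub h1) ?_ ?_
  · simp [orbitIntegral_apply]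
  · intro h
    rw [orbitIntegral_apply, ← (T h).intervalIntegral_comp_comm (T.intervalIntegrable_orbit x _ _),
      Pi.sub_apply, intervalIntegral.integral_interval_sub_left
        (hc.intervalIntegrable _ _) (hc.intervalIntegrable _ _)]
    have h3 := intervalIntegral.integral_comp_add_right (a := 0) (b := (t : ℝ))
      (fun s : ℝ => T s.toNNReal x) (h : ℝ)
    rw [zero_add] at h3
    rw [← h3]
    refine intervalIntegral.integral_congr fun s hs => ?_
    rw [Set.uIcc_of_le t.coe_nonneg] at hs
    have h4 : (s + h).toNNReal = h + s.toNNReal := by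
      rw [Real.toNNReal_add hs.1 h.coe_nonneg, Real.toNNReal_coe, add_comm]
    simp only [h4, apply_add]

include hM in
/-- If `‖T(t) (I - A)⁻¹‖ < 1` for some `t`, then `0` belongs to the resolvent set. -/
theorem zero_mem_resolventSet {t : ℝ≥0}
    (ht : ‖(T t).comp (resolventCLM T.generator 1)‖ < 1) :
    (0 : ℂ) ∈ opResolventSet T.generator := by
  have h1 : (1 : ℂ) ∈ opResolventSet T.generator := T.mem_resolventSet_of_re_pos hM (by simp)
  set R := resolventCLM T.generator 1 with hR
  set B := (T t).comp R with hB
  set V : (X →L[ℂ] X)ˣ := Units.oneSub B ht with hV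
  set W : X →L[ℂ] X := ((V⁻¹ : (X →L[ℂ] X)ˣ) : X →L[ℂ] X) with hW
  have hVW : ∀ x, W x - B (W x) = x := fun x => by
    have := congrArg (fun S : X →L[ℂ] X => S x) V.mul_inv
    simpa [hV, sub_mul] using this
  have hBT : ∀ s x, B (T s x) = T s (B x) := fun s x => by
    simp only [hB, ContinuousLinearMap.comp_apply, hR, ← T.resolventCLM_apply_comm h1]
    rw [T.apply_comm]
  have hWT : ∀ s x, W (T s x) = T s (W x) := fun s x => by
    have hc : Commute (T s) (V : X →L[ℂ] X) := by
      have : Commute (T s) B := ContinuousLinearMap.ext fun y => (hBT s y).symm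
      simpa [hV] using (Commute.one_right (T s)).sub_right this
    exact (congrArg (fun S : X →L[ℂ] X => S x) hc.units_inv_right.eq).symm
  have hRT : ∀ s x, R (T s x) = T s (R x) := fun s x => (T.resolventCLM_apply_comm h1 s x).symm
  -- The generator maps `R + ∫₀ᵗ T(s) R ds` to `(R - I) + (T(t) R - R) = T(t) R - I`. Composing with
  -- the Neumann inverse `W` of `I - T(t) R` therefore gives a right inverse of `-A`.
  refine (T.resolvent_eq_of_right_inverse
    (U := (R + (T.orbitIntegral hM t).comp R).comp W) (fun s x => ?_) (fun x => ?_)).1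
  · simp only [ContinuousLinearMap.comp_apply, _root_.add_apply, hWT, hRT,
      ← T.apply_orbitIntegral hM, _root_.map_add]
  · have h2 := T.mem_graph_coe (opResolvent T.generator 1 (W x))
    rw [apply_opResolvent h1, coe_opResolvent, ← hR] at h2
    have h3 := add_mem h2 (T.orbitIntegral_mem_graph hM t (R (W x)))
    convert! h3 using 1
    rw [Prod.mk_add_mk]
    congr 1
    have h4 := hVW x
    simp only [hB, ContinuousLinearMap.comp_apply] at h4
    conv_lhs => rw [← h4]
    rw [h4]
    simp only [zero_smul, one_smul]
    nth_rewrite 1 [← h4]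
    abel

end C0Semigroup

end SemigroupTheory
-- Damped outputs and their Fourier transforms.
namespace SemigroupTheory

section Observation

variable {X Y : Type*} [NormedAddCommGroup X] [NormedSpace ℂ X]
  [NormedAddCommGroup Y] [NormedSpace ℂ Y]

theorem IsGraphBounded.exists_comp_opResolvent {A : X →ₗ.[ℂ] X} {C : A.domain →ₗ[ℂ] Y}
    (hC : IsGraphBounded A C) {z : ℂ} (hz : z ∈ opResolventSet A) :
    ∃ D : X →L[ℂ] Y, ∀ x, D x = C (opResolvent A z x) := by
  obtain ⟨c, hc⟩ := hC
  set R := resolventCLM A z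
  refine ⟨LinearMap.mkContinuous (C ∘ₗ opResolvent A z) (|c| * (‖R‖ + (‖z‖ * ‖R‖ + 1)))
    fun x => ?_, fun x => rfl⟩
  have h1 : ‖R x‖ ≤ ‖R‖ * ‖x‖ := R.le_opNorm x
  have h2 : ‖z • R x - x‖ ≤ ‖z‖ * (‖R‖ * ‖x‖) + ‖x‖ := by
    refine (norm_sub_le _ _).trans ?_
    rw [norm_smul]
    gcongr
  have h3 := hc (opResolvent A z x)
  rw [apply_opResolvent hz, coe_opResolvent] at h3
  calc ‖(C ∘ₗ opResolvent A z) x‖ ≤ c * (‖R x‖ + ‖z • R x - x‖) := h3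
    _ ≤ |c| * (‖R‖ * ‖x‖ + (‖z‖ * (‖R‖ * ‖x‖) + ‖x‖)) := by
        refine mul_le_mul (le_abs_self c) (add_le_add h1 h2) (by positivity) (abs_nonneg c)
    _ = _ := by ring

theorem C0Semigroup.onDomain_opResolvent (T : C0Semigroup X) {z : ℂ}
    (hz : z ∈ opResolventSet T.generator) (t : ℝ≥0) (x : X) :
    T.onDomain t (opResolvent T.generator z x) = opResolvent T.generator z (T t x) :=
  Subtype.ext (T.resolventCLM_apply_comm hz t x)

end Observation

namespace C0Semigroup

open scoped FourierTransform

variable {X Y : Type*} [NormedAddCommGroup X] [NormedSpace ℂ X]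
  [NormedAddCommGroup Y] [NormedSpace ℂ Y] (T : C0Semigroup X)

/-- The damped output `t ↦ e^{-ξ t} D T(t) x` on the positive half-line, extended by zero. -/
noncomputable def dampedOutput (D : X →L[ℂ] Y) (ξ : ℝ) (x : X) : ℝ → Y :=
  (Set.Ioi 0).indicator fun t : ℝ => Complex.exp (-(ξ : ℂ) * t) • D (T t.toNNReal x)

theorem aestronglyMeasurable_dampedOutput (D : X →L[ℂ] Y) (ξ : ℝ) (x : X) :
    AEStronglyMeasurable (T.dampedOutput D ξ x) := by
  have h := T.continuous_orbit_real x
  have h' : Continuous fun t : ℝ => Complex.exp (-(ξ : ℂ) * t) • D (T t.toNNReal x) := by fun_prop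
  exact h'.aestronglyMeasurable.indicator measurableSet_Ioi

variable {M : ℝ} (hM : ∀ t, ‖T t‖ ≤ M) {ξ : ℝ} (hξ : 0 < ξ) (D : X →L[ℂ] Y) (x : X)
include hM hξ

theorem integrable_dampedOutput : Integrable (T.dampedOutput D ξ x) := by
  refine (integrable_indicator_iff measurableSet_Ioi).2 ?_
  have := D.integrable_comp
    (T.integrableOn_exp_smul_orbit hM (z := (ξ : ℂ)) (by simpa using hξ) x)
  simpa [IntegrableOn, map_smul] using this

theorem lintegral_enorm_dampedOutput_id_sq_le :
    ∫⁻ t, ‖T.dampedOutput (ContinuousLinearMap.id ℂ X) ξ x t‖ₑ ^ 2 ≤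
      ENNReal.ofReal (M ^ 2 * ‖x‖ ^ 2 / (2 * ξ)) := by
  have h2 : (-(2 * ξ)) < 0 := by linarith
  have h1 : ∀ t, ‖T.dampedOutput (ContinuousLinearMap.id ℂ X) ξ x t‖ₑ ^ 2 ≤
      (Set.Ioi (0 : ℝ)).indicator
        (fun t => ENNReal.ofReal (Real.exp (-(2 * ξ) * t) * (M * ‖x‖) ^ 2)) t := by
    intro t
    by_cases ht : t ∈ Set.Ioi (0 : ℝ)
    · rw [dampedOutput, Set.indicator_of_mem ht, Set.indicator_of_mem ht, ← ofReal_norm,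
        ← ENNReal.ofReal_pow (norm_nonneg _)]
      refine ENNReal.ofReal_le_ofReal ?_
      have h := pow_le_pow_left₀ (norm_nonneg _) (T.norm_exp_smul_orbit_le hM (ξ : ℂ) x t) 2
      refine h.trans_eq ?_
      rw [mul_pow, ← Real.exp_nat_mul]
      congr 2
      simp
      ring
    · simp [dampedOutput, Set.indicator_of_notMem ht]
  refine (lintegral_mono h1).trans ?_
  rw [lintegral_indicator measurableSet_Ioi, ← ofReal_integral_eq_lintegral_ofReal
    ((integrableOn_exp_mul_Ioi h2 0).mul_const _)
    (Eventually.of_forall fun t => by positivity), integral_mul_const, integral_exp_mul_Ioi h2]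
  refine ENNReal.ofReal_le_ofReal (le_of_eq ?_)
  simp
  field_simp

theorem memLp_dampedOutput : MemLp (T.dampedOutput D ξ x) 2 := by
  have h2 : MemLp (T.dampedOutput (ContinuousLinearMap.id ℂ X) ξ x) 2 := by
    refine ⟨T.aestronglyMeasurable_dampedOutput _ ξ x, ?_⟩
    rw [eLpNorm_lt_top_iff_lintegral_rpow_enorm_lt_top (by norm_num) (by norm_num)]
    have := (T.lintegral_enorm_dampedOutput_id_sq_le hM hξ x).trans_lt ENNReal.ofReal_lt_top
    simpa using this
  convert! D.comp_memLp' h2 using 1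
  funext t
  by_cases ht : t ∈ Set.Ioi (0 : ℝ)
  · simp [dampedOutput, Set.indicator_of_mem ht]
  · simp [dampedOutput, Set.indicator_of_notMem ht]

theorem fourier_dampedOutput [CompleteSpace X] [CompleteSpace Y] (η : ℝ) :
    𝓕 (T.dampedOutput D ξ x) η =
      D (resolventCLM T.generator (ξ + (2 * Real.pi * η : ℝ) * Complex.I) x) := by
  have hz : 0 < ((ξ : ℂ) + (2 * Real.pi * η : ℝ) * Complex.I).re := by simpa using hξ
  rw [Real.fourier_real_eq_integral_exp_smul, T.resolventCLM_apply_eq_integral hM hz,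
    ← D.integral_comp_comm (T.integrableOn_exp_smul_orbit hM hz x),
    ← integral_indicator measurableSet_Ioi]
  congr 1
  funext t
  by_cases ht : t ∈ Set.Ioi (0 : ℝ)
  · rw [dampedOutput, Set.indicator_of_mem ht, Set.indicator_of_mem ht, smul_smul,
      ← Complex.exp_add, map_smul]
    congr 2
    push_cast
    ring
  · rw [dampedOutput, Set.indicator_of_notMem ht, Set.indicator_of_notMem ht, smul_zero]

end C0Semigroup

end SemigroupTheory
-- From the Weiss condition to uniform energy on blocks.
namespace SemigroupTheory

namespace C0Semigroup

open scoped FourierTransform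

variable {X Y : Type*} [NormedAddCommGroup X] [InnerProductSpace ℂ X] [CompleteSpace X]
  [NormedAddCommGroup Y] [InnerProductSpace ℂ Y] [CompleteSpace Y] (T : C0Semigroup X)
  {M : ℝ} (hM : ∀ t, ‖T t‖ ≤ M)
  {C : T.generator.domain →ₗ[ℂ] Y} {D : X →L[ℂ] Y}
  (hD : ∀ x, D x = C (opResolvent T.generator 1 x))

-- The resolvent identity between the lines `Re z = ξ` and `Re z = 2ξ` produces the factor `ξ`. The
-- inner resolvent is the transform of a damped orbit, so Plancherel can be used a second time; an
-- undifferenced output would leave no such `L²` factor.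
include hM hD in
theorem fourier_dampedOutput_sub {ξ : ℝ} (hξ : 0 < ξ) (x : X) (η : ℝ) :
    𝓕 (T.dampedOutput D ξ x - T.dampedOutput D (2 * ξ) x) η =
      (ξ : ℂ) • C (opResolvent T.generator (ξ + (2 * Real.pi * η : ℝ) * Complex.I)
        (𝓕 (T.dampedOutput (ContinuousLinearMap.id ℂ X) (2 * ξ)
          (resolventCLM T.generator 1 x)) η)) := by
  have hξ2 : 0 < 2 * ξ := by linarith
  set z₁ : ℂ := (ξ : ℂ) + (2 * Real.pi * η : ℝ) * Complex.I with hz₁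
  set z₂ : ℂ := ((2 * ξ : ℝ) : ℂ) + (2 * Real.pi * η : ℝ) * Complex.I with hz₂
  have h0 : (1 : ℂ) ∈ opResolventSet T.generator := T.mem_resolventSet_of_re_pos hM (by simp)
  have h1 : z₁ ∈ opResolventSet T.generator :=
    T.mem_resolventSet_of_re_pos hM (by simpa [hz₁] using hξ)
  have h2 : z₂ ∈ opResolventSet T.generator :=
    T.mem_resolventSet_of_re_pos hM (by simpa [hz₂] using hξ)
  have hsub : 𝓕 (T.dampedOutput D ξ x - T.dampedOutput D (2 * ξ) x) η =
      𝓕 (T.dampedOutput D ξ x) η - 𝓕 (T.dampedOutput D (2 * ξ) x) η := by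
    rw [Real.fourier_real_eq, Real.fourier_real_eq, Real.fourier_real_eq, ← integral_sub]
    · simp only [Pi.sub_apply, smul_sub]
    · simpa [mul_comm] using (Real.fourierIntegral_convergent_iff η).2
        (T.integrable_dampedOutput hM hξ D x)
    · simpa [mul_comm] using (Real.fourierIntegral_convergent_iff η).2
        (T.integrable_dampedOutput hM hξ2 D x)
  rw [hsub, T.fourier_dampedOutput hM hξ, T.fourier_dampedOutput hM hξ2,
    T.fourier_dampedOutput hM hξ2, ← hz₁, ← hz₂, ← map_sub,
    resolventCLM_sub_resolventCLM h1 h2, map_smul, hD]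
  have h3 : z₂ - z₁ = ξ := by
    rw [hz₁, hz₂]
    push_cast
    ring
  rw [h3]
  congr 2
  apply Subtype.ext
  simp only [coe_opResolvent, ContinuousLinearMap.id_apply]
  rw [resolventCLM_comm h0 h1, resolventCLM_comm h0 h2]

include hM hD in
/-- If `C` satisfies the `2`-Weiss condition, then its damped outputs are square-integrable
uniformly in the damping. -/
theorem lintegral_enorm_dampedOutput_sub_sq_le {K : ℝ}
    (hK : ∀ z : ℂ, 0 < z.re → ∀ x : X,
      ‖C (opResolvent T.generator z x)‖ ≤ K / z.re ^ (1 - (2 : ℝ≥0∞).toReal⁻¹) * ‖x‖)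
    {ξ : ℝ} (hξ : 0 < ξ) (x : X) :
    ∫⁻ t, ‖(T.dampedOutput D ξ x - T.dampedOutput D (2 * ξ) x) t‖ₑ ^ 2 ≤
      ENNReal.ofReal (K ^ 2 * M ^ 2 / 4 * ‖resolventCLM T.generator 1 x‖ ^ 2) := by
  have hξ2 : 0 < 2 * ξ := by linarith
  set w := resolventCLM T.generator 1 x
  set g := T.dampedOutput (ContinuousLinearMap.id ℂ X) (2 * ξ) w
  rw [← MemLp.lintegral_enorm_fourier_sq
    ((T.integrable_dampedOutput hM hξ D x).sub (T.integrable_dampedOutput hM hξ2 D x))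
    ((T.memLp_dampedOutput hM hξ D x).sub (T.memLp_dampedOutput hM hξ2 D x))]
  have h1 : ∀ η, ‖𝓕 (T.dampedOutput D ξ x - T.dampedOutput D (2 * ξ) x) η‖ₑ ^ 2 ≤
      ENNReal.ofReal (ξ * K ^ 2) * ‖𝓕 g η‖ₑ ^ 2 := by
    intro η
    rw [T.fourier_dampedOutput_sub hM hD hξ, ← ofReal_norm, ← ofReal_norm,
      ← ENNReal.ofReal_pow (norm_nonneg _), ← ENNReal.ofReal_pow (norm_nonneg _),
      ← ENNReal.ofReal_mul (by positivity)]
    refine ENNReal.ofReal_le_ofReal ?_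
    have hre : ((ξ : ℂ) + (2 * Real.pi * η : ℝ) * Complex.I).re = ξ := by simp
    have h2 := hK ((ξ : ℂ) + (2 * Real.pi * η : ℝ) * Complex.I) (by rw [hre]; exact hξ) (𝓕 g η)
    rw [hre] at h2
    -- The Weiss exponent is `1/2`; squared, it cancels one of the two factors `ξ`.
    have h3 : (ξ ^ (1 - (2 : ℝ≥0∞).toReal⁻¹)) ^ 2 = ξ := by
      rw [← Real.rpow_natCast, ← Real.rpow_mul hξ.le]
      norm_num
    rw [norm_smul, Complex.norm_real, Real.norm_of_nonneg hξ.le, mul_pow]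
    calc ξ ^ 2 * _ ^ 2 ≤ ξ ^ 2 * (K / ξ ^ (1 - (2 : ℝ≥0∞).toReal⁻¹) * ‖𝓕 g η‖) ^ 2 := by
          gcongr
      _ = ξ * K ^ 2 * ‖𝓕 g η‖ ^ 2 := by
          rw [mul_pow, div_pow, h3]
          field_simp
  refine (lintegral_mono h1).trans ?_
  rw [lintegral_const_mul' _ _ ENNReal.ofReal_ne_top, MemLp.lintegral_enorm_fourier_sq
    (T.integrable_dampedOutput hM hξ2 _ w) (T.memLp_dampedOutput hM hξ2 _ w)]
  refine (mul_le_mul_right (T.lintegral_enorm_dampedOutput_id_sq_le hM hξ2 w) _).trans ?_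
  rw [← ENNReal.ofReal_mul (by positivity)]
  refine ENNReal.ofReal_le_ofReal (le_of_eq ?_)
  field_simp
  ring

include hM in
/-- The `2`-Weiss condition bounds the output energy on the intervals `(τ, 3τ]`, uniformly
in `τ`. -/
theorem exists_lintegral_output_le (hC : IsGraphBounded T.generator C)
    (hW : WeissCondition 2 T.generator C) :
    ∃ N : ℝ, 0 ≤ N ∧ ∀ (x : T.generator.domain) (τ : ℝ), 0 < τ →
      ∫⁻ t in Set.Ioc τ (3 * τ), ‖C (T.onDomain t.toNNReal x)‖ₑ ^ 2 ≤
        ENNReal.ofReal (N * ‖(x : X)‖ ^ 2) := by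
  obtain ⟨K, hK0, hK⟩ := hW
  have h0 : (1 : ℂ) ∈ opResolventSet T.generator := T.mem_resolventSet_of_re_pos hM (by simp)
  obtain ⟨D, hD⟩ := hC.exists_comp_opResolvent h0
  -- With `ξ = 1/τ` and `u = t/τ ∈ (1, 3]`, the weight is `e^(-u) (1 - e^(-u))`, and `c` bounds it
  -- below: the first factor is at least `e^(-3)`, the second at least `1 - e^(-1)`.
  obtain ⟨c, hc⟩ : ∃ c : ℝ, c = Real.exp (-3) * (1 - Real.exp (-1)) := ⟨_, rfl⟩
  have hc1 : 0 < 1 - Real.exp (-1) := by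
    rw [sub_pos, Real.exp_lt_one_iff]
    norm_num
  have hc0 : 0 < c := by rw [hc]; positivity
  refine ⟨(c ^ 2)⁻¹ * (K ^ 2 * M ^ 2 / 4), by positivity, fun x τ hτ => ?_⟩
  set v := shift T.generator 1 x with hv
  have hξ : 0 < τ⁻¹ := inv_pos.2 hτ
  have h1 := T.lintegral_enorm_dampedOutput_sub_sq_le hM hD hK hξ v
  rw [← coe_opResolvent, hv, opResolvent_shift h0, ← hv] at h1
  have h2 : ∀ t ∈ Set.Ioc τ (3 * τ), ‖C (T.onDomain t.toNNReal x)‖ₑ ^ 2 ≤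
      ENNReal.ofReal (c ^ 2)⁻¹ *
        ‖(T.dampedOutput D τ⁻¹ v - T.dampedOutput D (2 * τ⁻¹) v) t‖ₑ ^ 2 := by
    intro t ht
    have ht0 : t ∈ Set.Ioi (0 : ℝ) := hτ.trans ht.1
    have h3 : C (T.onDomain t.toNNReal x) = D (T t.toNNReal v) := by
      rw [hD, ← T.onDomain_opResolvent h0, hv, opResolvent_shift h0]
    have h4 : (T.dampedOutput D τ⁻¹ v - T.dampedOutput D (2 * τ⁻¹) v) t =
        ((Real.exp (-(t / τ)) * (1 - Real.exp (-(t / τ))) : ℝ) : ℂ) • D (T t.toNNReal v) := by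
      rw [Pi.sub_apply, dampedOutput, dampedOutput, Set.indicator_of_mem ht0,
        Set.indicator_of_mem ht0, ← sub_smul]
      congr 1
      rw [mul_sub, mul_one, ← Real.exp_add]
      push_cast
      congr 2 <;> ring
    rw [h3, h4, ← ofReal_norm, ← ofReal_norm, ← ENNReal.ofReal_pow (norm_nonneg _),
      ← ENNReal.ofReal_pow (norm_nonneg _), ← ENNReal.ofReal_mul (by positivity)]
    refine ENNReal.ofReal_le_ofReal ?_
    have h5 : c ≤ Real.exp (-(t / τ)) * (1 - Real.exp (-(t / τ))) := by
      have h6 : 1 ≤ t / τ := (one_le_div hτ).2 ht.1.le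
      have h7 : t / τ ≤ 3 := (div_le_iff₀ hτ).2 ht.2
      have h8 : Real.exp (-3) ≤ Real.exp (-(t / τ)) := Real.exp_le_exp.2 (by linarith)
      have h9 : Real.exp (-(t / τ)) ≤ Real.exp (-1) := Real.exp_le_exp.2 (by linarith)
      rw [hc]
      exact mul_le_mul h8 (by linarith) hc1.le (Real.exp_pos _).le
    rw [norm_smul, Complex.norm_real, mul_pow, ← mul_assoc]
    have h6 : 1 ≤ (c ^ 2)⁻¹ *
        ‖Real.exp (-(t / τ)) * (1 - Real.exp (-(t / τ)))‖ ^ 2 := by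
      rw [← div_eq_inv_mul, one_le_div (by positivity), Real.norm_of_nonneg (hc0.le.trans h5)]
      gcongr
    exact le_mul_of_one_le_left (by positivity) h6
  calc ∫⁻ t in Set.Ioc τ (3 * τ), ‖C (T.onDomain t.toNNReal x)‖ₑ ^ 2
      ≤ ∫⁻ t in Set.Ioc τ (3 * τ), ENNReal.ofReal (c ^ 2)⁻¹ *
        ‖(T.dampedOutput D τ⁻¹ v - T.dampedOutput D (2 * τ⁻¹) v) t‖ₑ ^ 2 :=
        setLIntegral_mono' measurableSet_Ioc h2
    _ ≤ ∫⁻ t, ENNReal.ofReal (c ^ 2)⁻¹ *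
        ‖(T.dampedOutput D τ⁻¹ v - T.dampedOutput D (2 * τ⁻¹) v) t‖ₑ ^ 2 :=
        setLIntegral_le_lintegral _ _
    _ ≤ ENNReal.ofReal (c ^ 2)⁻¹ *
        ENNReal.ofReal (K ^ 2 * M ^ 2 / 4 * ‖(x : X)‖ ^ 2) := by
        rw [lintegral_const_mul' _ _ ENNReal.ofReal_ne_top]
        gcongr
    _ = _ := by
        rw [← ENNReal.ofReal_mul (by positivity), mul_assoc]

end C0Semigroup

end SemigroupTheory
-- Resolvent bounds on the half-line and Frullani's integral.
namespace SemigroupTheory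

theorem integrableOn_rpow_mul_min_rpow {p θ : ℝ} (hp : -1 < p) (hθ : p - θ < -1) :
    IntegrableOn (fun s : ℝ => s ^ p * (min 1 s⁻¹) ^ θ) (Set.Ioi 0) := by
  rw [← Set.Ioc_union_Ioi_eq_Ioi zero_le_one]
  refine IntegrableOn.union ?_ ?_
  · have h1 : IntegrableOn (fun s : ℝ => s ^ p) (Set.Ioc 0 1) :=
      (intervalIntegrable_iff_integrableOn_Ioc_of_le zero_le_one).1
        (intervalIntegral.intervalIntegrable_rpow' hp)
    refine h1.congr_fun (fun s hs => ?_) measurableSet_Ioc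
    simp [min_eq_left ((one_le_inv₀ hs.1).2 hs.2)]
  · refine (integrableOn_Ioi_rpow_of_lt hθ one_pos).congr_fun (fun s hs => ?_) measurableSet_Ioi
    have hs0 : (0 : ℝ) < s := one_pos.trans hs
    simp only
    rw [min_eq_right (inv_le_one_of_one_le₀ (le_of_lt hs)), Real.inv_rpow hs0.le,
      Real.rpow_sub hs0, div_eq_mul_inv]

theorem IntegrableOn.rpow_smul_of_bound {E : Type*} [NormedAddCommGroup E] [NormedSpace ℝ E]
    {f : ℝ → E} {c p : ℝ} (hf : ContinuousOn f (Set.Ioi 0))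
    (hc : ∀ s, 0 < s → ‖f s‖ ≤ c * min 1 s⁻¹) (hp : -1 < p) (hp0 : p < 0) :
    IntegrableOn (fun s : ℝ => s ^ p • f s) (Set.Ioi 0) := by
  have h1 : IntegrableOn (fun s : ℝ => c * (s ^ p * (min 1 s⁻¹) ^ (1 : ℝ))) (Set.Ioi 0) :=
    Integrable.const_mul (integrableOn_rpow_mul_min_rpow hp (by linarith)) c
  refine Integrable.mono' h1 ?_ ?_
  · refine ContinuousOn.aestronglyMeasurable (ContinuousOn.smul ?_ hf) measurableSet_Ioi
    exact fun s hs => (Real.continuousAt_rpow_const s p (Or.inl hs.ne')).continuousWithinAt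
  · filter_upwards [ae_restrict_mem measurableSet_Ioi] with s hs
    have hs : (0 : ℝ) < s := hs
    rw [norm_smul, Real.norm_of_nonneg (by positivity), Real.rpow_one, mul_left_comm]
    exact mul_le_mul_of_nonneg_left (hc s hs) (by positivity)

namespace C0Semigroup

variable {X : Type*} [NormedAddCommGroup X] [NormedSpace ℂ X] [CompleteSpace X]
  (T : C0Semigroup X) {M : ℝ} (hM : ∀ t, ‖T t‖ ≤ M)
  (h0 : (0 : ℂ) ∈ opResolventSet T.generator)

include hM

omit [CompleteSpace X] in
theorem bound_nonneg : 0 ≤ M := (norm_nonneg _).trans (hM 0)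

theorem ofReal_mem_resolventSet {s : ℝ} (hs : 0 < s) : (s : ℂ) ∈ opResolventSet T.generator :=
  T.mem_resolventSet_of_re_pos hM (by simpa using hs)

theorem norm_resolventCLM_ofReal_apply_le {s : ℝ} (hs : 0 < s) (x : X) :
    ‖resolventCLM T.generator s x‖ ≤ M / s * ‖x‖ :=
  T.norm_resolventCLM_apply_le hM (by simpa using hs) x

theorem resolventCLM_shift_zero {s : ℝ} (hs : 0 < s) (x : T.generator.domain) :
    resolventCLM T.generator s (shift T.generator 0 x) =
      (x : X) - (s : ℂ) • resolventCLM T.generator s x := by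
  have h := congrArg Subtype.val (opResolvent_shift (T.ofReal_mem_resolventSet hM hs) x)
  rw [coe_opResolvent, shift_apply, map_sub, map_smul] at h
  rw [shift_apply, zero_smul, zero_sub, map_neg, eq_sub_iff_add_eq, neg_add_eq_sub]
  exact h

/-- This exhibits the Frullani integrand as a derivative: the right-hand side is `d/ds` of `∫ r in
s..ρs, R(r, A) x`. -/
theorem resolventCLM_resolventCLM_shift_zero {s ρ : ℝ} (hs : 0 < s) (hρ : 0 < ρ)
    (x : T.generator.domain) :
    (ρ - 1) • resolventCLM T.generator s
        (resolventCLM T.generator (ρ * s : ℝ) (shift T.generator 0 x)) =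
      ρ • resolventCLM T.generator (ρ * s : ℝ) x - resolventCLM T.generator s x := by
  set v := shift T.generator 0 x with hv
  have h : ((ρ * s : ℝ) : ℂ) • resolventCLM T.generator (ρ * s : ℝ) x -
      (s : ℂ) • resolventCLM T.generator s x =
      (((ρ * s : ℝ) : ℂ) - s) • resolventCLM T.generator s
        (resolventCLM T.generator (ρ * s : ℝ) v) := by
    rw [← resolventCLM_sub_resolventCLM (T.ofReal_mem_resolventSet hM hs)
      (T.ofReal_mem_resolventSet hM (mul_pos hρ hs)), hv, T.resolventCLM_shift_zero hM hs,
      T.resolventCLM_shift_zero hM (mul_pos hρ hs), sub_sub_sub_cancel_left]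
  have hs' : (s : ℂ) ≠ 0 := by exact_mod_cast hs.ne'
  apply smul_right_injective X hs'
  simp only [← Complex.coe_smul, smul_sub, smul_smul]
  have h1 : (s : ℂ) * ((ρ - 1 : ℝ) : ℂ) = ((ρ * s : ℝ) : ℂ) - s := by push_cast; ring
  have h2 : (s : ℂ) * (ρ : ℂ) = ((ρ * s : ℝ) : ℂ) := by push_cast; ring
  rw [h1, h2, ← h]

theorem norm_sub_smul_resolventCLM_le {s : ℝ} (hs : 0 < s) (x : X) :
    ‖x - (s : ℂ) • resolventCLM T.generator s x‖ ≤ (1 + M) * ‖x‖ := by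
  refine (norm_sub_le _ _).trans ?_
  have h := T.norm_resolventCLM_ofReal_apply_le hM hs x
  rw [norm_smul, Complex.norm_real, Real.norm_of_nonneg hs.le, add_mul, one_mul]
  refine add_le_add_right ((mul_le_mul_of_nonneg_left h hs.le).trans_eq ?_) _
  field_simp

include h0

theorem resolventCLM_ofReal_apply {s : ℝ} (hs : 0 < s) (x : X) :
    resolventCLM T.generator s x =
      resolventCLM T.generator 0 (x - (s : ℂ) • resolventCLM T.generator s x) := by
  have h := resolventCLM_sub_resolventCLM h0 (T.ofReal_mem_resolventSet hM hs) x
  rw [sub_zero] at h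
  rw [map_sub, map_smul, ← h, sub_sub_cancel]

/-- Boundedness near `0` comes from `R(s) = R(0) (I - s R(s))` with `‖s R(s)‖ ≤ M`; decay at
infinity is the bound `M / s`. -/
theorem exists_norm_resolventCLM_le :
    ∃ c : ℝ, 0 ≤ c ∧ ∀ s : ℝ, 0 < s → ‖resolventCLM T.generator s‖ ≤ c * min 1 s⁻¹ := by
  have hM0 := T.bound_nonneg hM
  refine ⟨max (‖resolventCLM T.generator 0‖ * (1 + M)) M, hM0.trans (le_max_right _ _),
    fun s hs => ?_⟩
  rw [mul_min_of_nonneg _ _ (hM0.trans (le_max_right _ _)), mul_one]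
  refine le_min ?_ ?_
  · refine le_trans (ContinuousLinearMap.opNorm_le_bound _ (by positivity) fun x => ?_)
      (le_max_left _ _)
    rw [T.resolventCLM_ofReal_apply hM h0 hs, mul_assoc]
    exact (ContinuousLinearMap.le_opNorm _ _).trans
      (by gcongr; exact T.norm_sub_smul_resolventCLM_le hM hs x)
  · refine (ContinuousLinearMap.opNorm_le_bound _ (by positivity)
      (T.norm_resolventCLM_ofReal_apply_le hM hs)).trans ?_
    rw [div_eq_mul_inv]
    gcongr
    exact le_max_right _ _

/-- The resolvent is Lipschitz continuous on the closed half-line. -/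
theorem continuousOn_resolventCLM :
    ContinuousOn (fun s : ℝ => resolventCLM T.generator s) (Set.Ici 0) := by
  obtain ⟨c, hc0, hc⟩ := T.exists_norm_resolventCLM_le hM h0
  set c' := max c ‖resolventCLM T.generator 0‖
  have hc'0 : 0 ≤ c' := hc0.trans (le_max_left _ _)
  have hmem : ∀ s ∈ Set.Ici (0 : ℝ), (s : ℂ) ∈ opResolventSet T.generator := by
    intro s hs
    rcases (Set.mem_Ici.1 hs).eq_or_lt with rfl | h
    · simpa using h0
    · exact T.ofReal_mem_resolventSet hM h
  have hc' : ∀ s ∈ Set.Ici (0 : ℝ), ‖resolventCLM T.generator s‖ ≤ c' := by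
    intro s hs
    rcases (Set.mem_Ici.1 hs).eq_or_lt with rfl | h
    · simp [c']
    · exact (hc s h).trans ((mul_le_of_le_one_right hc0 (min_le_left _ _)).trans (le_max_left _ _))
  have hL : LipschitzOnWith (Real.toNNReal (c' * c'))
      (fun s : ℝ => resolventCLM T.generator s) (Set.Ici 0) := by
    refine LipschitzOnWith.of_dist_le_mul fun s hs r hr => ?_
    rw [Real.coe_toNNReal _ (by positivity), dist_eq_norm, dist_comm, Real.dist_eq]
    refine ContinuousLinearMap.opNorm_le_bound _ (by positivity) fun x => ?_
    rw [sub_apply, resolventCLM_sub_resolventCLM (hmem s hs) (hmem r hr),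
      norm_smul, ← Complex.ofReal_sub, Complex.norm_real, Real.norm_eq_abs, mul_comm (c' * c'),
      mul_assoc, mul_assoc]
    gcongr
    refine (ContinuousLinearMap.le_of_opNorm_le _ (hc' s hs) _).trans ?_
    gcongr
    exact ContinuousLinearMap.le_of_opNorm_le _ (hc' r hr) _
  exact hL.continuousOn

/-- Frullani's integral for the resolvent. -/
theorem integral_resolventCLM_resolventCLM {ρ : ℝ} (hρ : 0 < ρ) (hρ1 : ρ ≠ 1)
    (x : T.generator.domain)
    (hint : IntegrableOn (fun s : ℝ => resolventCLM T.generator s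
      (resolventCLM T.generator (ρ * s : ℝ) (shift T.generator 0 x))) (Set.Ioi 0)) :
    ∫ s in Set.Ioi (0 : ℝ), resolventCLM T.generator s
      (resolventCLM T.generator (ρ * s : ℝ) (shift T.generator 0 x)) =
        (Real.log ρ / (ρ - 1)) • (x : X) := by
  set v := shift T.generator 0 x with hv
  -- Freezing the resolvent at its value at `0` for negative `s` makes `g` continuous on the whole
  -- line, so the fundamental theorem of calculus applies also at the endpoint `0`.
  set g : ℝ → X := fun s => resolventCLM T.generator ((max s 0 : ℝ) : ℂ) x with hg
  have hgs : ∀ s, 0 < s → g s = resolventCLM T.generator s x := fun s hs => by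
    rw [hg]
    simp only [max_eq_left hs.le]
  have hgc : Continuous g := by
    have h1 : Continuous fun s : ℝ => resolventCLM T.generator ((max s 0 : ℝ) : ℂ) :=
      (T.continuousOn_resolventCLM hM h0).comp_continuous
        (continuous_id.max continuous_const) fun s => Set.mem_Ici.2 (le_max_right _ _)
    exact h1.clm_apply continuous_const
  set Φ : ℝ → X := fun N => ∫ s in N..(ρ * N), g s with hΦ
  have hΦ' : ∀ N, HasDerivAt Φ (ρ • g (ρ * N) - g N) N := by
    intro N
    have h1 := (hgc.integral_hasStrictDerivAt 0 (ρ * N)).hasDerivAt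
    have h2 := (hgc.integral_hasStrictDerivAt 0 N).hasDerivAt
    have h3 : HasDerivAt (fun N : ℝ => ρ * N) ρ N := by
      simpa using (hasDerivAt_id N).const_mul ρ
    refine ((h1.scomp N h3).sub h2).congr_of_eventuallyEq (Eventually.of_forall fun N' => ?_)
    simp only [hΦ, Pi.sub_apply, Function.comp_apply]
    rw [intervalIntegral.integral_interval_sub_left
        (hgc.intervalIntegrable _ _) (hgc.intervalIntegrable _ _)]
  -- Since `R(s) x = s⁻¹ x - s⁻¹ R(s) v`, the first term integrates to `log ρ • x`, and the second
  -- is `O(s⁻²)` on an interval of length `|ρ - 1| N`, contributing `O(N⁻¹)`.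
  have hlim : Tendsto Φ atTop (𝓝 (Real.log ρ • (x : X))) := by
    set m := min 1 ρ with hm
    have hm0 : 0 < m := lt_min one_pos hρ
    have hb : ∀ N : ℝ, 0 < N →
        ‖Φ N - Real.log ρ • (x : X)‖ ≤ (M * ‖v‖ / m ^ 2 * |ρ - 1|) * N⁻¹ := by
      intro N hN
      have hsub : ∀ s ∈ Set.uIcc N (ρ * N), m * N ≤ s := by
        intro s hs
        refine le_trans ?_ hs.1
        refine le_min ?_ ?_
        · exact mul_le_of_le_one_left hN.le (min_le_left _ _)
        · exact mul_le_mul_of_nonneg_right (min_le_right _ _) hN.le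
      have hmN : 0 < m * N := mul_pos hm0 hN
      have h0mem : (0 : ℝ) ∉ Set.uIcc N (ρ * N) := fun h => absurd (hsub 0 h) (not_le.2 hmN)
      have h1 : Real.log ρ • (x : X) = ∫ s in N..(ρ * N), s⁻¹ • (x : X) := by
        rw [intervalIntegral.integral_smul_const, integral_inv h0mem, mul_div_cancel_right₀ _ hN.ne']
      have h2 : IntervalIntegrable (fun s : ℝ => s⁻¹ • (x : X)) volume N (ρ * N) :=
        ContinuousOn.intervalIntegrable ((continuousOn_inv₀.mono fun s hs =>
          ne_of_mem_of_not_mem hs h0mem).smul continuousOn_const)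
      rw [h1, hΦ]
      simp only
      rw [← intervalIntegral.integral_sub (hgc.intervalIntegrable _ _) h2]
      have h3 : ∀ s ∈ Set.uIoc N (ρ * N),
          ‖g s - s⁻¹ • (x : X)‖ ≤ (m * N)⁻¹ * (M / (m * N) * ‖v‖) := by
        intro s hs
        have h4 := hsub s (Set.uIoc_subset_uIcc hs)
        have hs0 : 0 < s := hmN.trans_le h4
        have h5 : g s - s⁻¹ • (x : X) = -(s⁻¹ • resolventCLM T.generator s v) := by
          rw [hgs s hs0, hv, T.resolventCLM_shift_zero hM hs0, smul_sub, Complex.coe_smul,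
            smul_smul, inv_mul_cancel₀ hs0.ne', one_smul, neg_sub]
        rw [h5, norm_neg, norm_smul, Real.norm_of_nonneg (inv_nonneg.2 hs0.le)]
        have hM0 := T.bound_nonneg hM
        gcongr
        refine (T.norm_resolventCLM_ofReal_apply_le hM hs0 v).trans ?_
        gcongr
      refine (intervalIntegral.norm_integral_le_of_norm_le_const h3).trans (le_of_eq ?_)
      have h6 : |ρ * N - N| = |ρ - 1| * N := by
        rw [← sub_one_mul, abs_mul, abs_of_pos hN]
      rw [h6]
      field_simp
    refine tendsto_iff_norm_sub_tendsto_zero.2 (squeeze_zero' (Eventually.of_forall fun _ =>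
      norm_nonneg _) ((eventually_gt_atTop 0).mono hb) ?_)
    simpa using tendsto_inv_atTop_zero.const_mul (M * ‖v‖ / m ^ 2 * |ρ - 1|)
  have hderiv : ∀ s ∈ Set.Ioi (0 : ℝ), HasDerivAt Φ ((ρ - 1) • resolventCLM T.generator s
      (resolventCLM T.generator (ρ * s : ℝ) v)) s := by
    intro s hs
    rw [hv, T.resolventCLM_resolventCLM_shift_zero hM hs hρ, ← hgs s hs,
      ← hgs _ (mul_pos hρ hs)]
    exact hΦ' s
  have key := integral_Ioi_of_hasDerivAt_of_tendsto
    (hΦ' 0).continuousAt.continuousWithinAt hderiv (Integrable.smul (ρ - 1) hint) hlim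
  rw [integral_smul] at key
  have hρ2 : ρ - 1 ≠ 0 := sub_ne_zero.2 hρ1
  have h7 : Φ 0 = 0 := by simp [hΦ]
  rw [h7, sub_zero] at key
  rw [div_eq_inv_mul, mul_smul, ← key, smul_smul, inv_mul_cancel₀ hρ2, one_smul]

end C0Semigroup

end SemigroupTheory
-- Negative fractional powers and their decay.
namespace SemigroupTheory

namespace C0Semigroup

variable {X : Type*} [NormedAddCommGroup X] [NormedSpace ℂ X] [CompleteSpace X]
  (T : C0Semigroup X)

/-- A positive multiple of the negative fractional power `(-A) ^ (-b)` for `0 < b < 1`. -/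
noncomputable def negPowIntegral (b : ℝ) : X →L[ℂ] X :=
  ∫ s in Set.Ioi (0 : ℝ), s ^ (-b) • resolventCLM T.generator s

variable {M : ℝ} (hM : ∀ t, ‖T t‖ ≤ M)
  (h0 : (0 : ℂ) ∈ opResolventSet T.generator) {b : ℝ} (hb : 0 < b) (hb1 : b < 1)

include hM h0 in
theorem continuousOn_resolventCLM_Ioi :
    ContinuousOn (fun s : ℝ => resolventCLM T.generator s) (Set.Ioi 0) :=
  (T.continuousOn_resolventCLM hM h0).mono Set.Ioi_subset_Ici_self

include hM h0 hb hb1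

theorem integrableOn_rpow_smul_resolventCLM :
    IntegrableOn (fun s : ℝ => s ^ (-b) • resolventCLM T.generator s) (Set.Ioi 0) := by
  obtain ⟨c, -, hc⟩ := T.exists_norm_resolventCLM_le hM h0
  exact IntegrableOn.rpow_smul_of_bound (T.continuousOn_resolventCLM_Ioi hM h0) hc
    (by linarith) (by linarith)

theorem negPowIntegral_apply (x : X) : T.negPowIntegral b x =
    ∫ s in Set.Ioi (0 : ℝ), s ^ (-b) • resolventCLM T.generator s x := by
  rw [negPowIntegral, ContinuousLinearMap.integral_apply
    (T.integrableOn_rpow_smul_resolventCLM hM h0 hb hb1)]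
  simp only [_root_.smul_apply]

theorem integrableOn_rpow_smul_resolventCLM_apply (x : X) :
    IntegrableOn (fun s : ℝ => s ^ (-b) • resolventCLM T.generator s x) (Set.Ioi 0) :=
  (T.integrableOn_rpow_smul_resolventCLM hM h0 hb hb1).apply_continuousLinearMap x

theorem map_negPowIntegral {S : X →L[ℂ] X} (hS : ∀ t x, S (T t x) = T t (S x)) (x : X) :
    S (T.negPowIntegral b x) = T.negPowIntegral b (S x) := by
  rw [T.negPowIntegral_apply hM h0 hb hb1, T.negPowIntegral_apply hM h0 hb hb1,
    ← S.integral_comp_comm (T.integrableOn_rpow_smul_resolventCLM_apply hM h0 hb hb1 x)]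
  refine setIntegral_congr_fun measurableSet_Ioi fun s hs => ?_
  rw [← Complex.coe_smul, ← Complex.coe_smul, map_smul,
    T.map_resolventCLM_comm hS (T.ofReal_mem_resolventSet hM hs)]

/-- This licenses Fubini below. Substituting `r = ρ s`, the inner integral of norms is at most a
constant times `min 1 s⁻¹ * s^(b - 1)`, which is integrable because `0 < b < 1`. -/
theorem integrable_resolventCLM_prod (v : X) :
    Integrable (fun p : ℝ × ℝ => p.2 ^ (-b) • resolventCLM T.generator p.1
      (resolventCLM T.generator (p.2 * p.1 : ℝ) v))
      ((volume.restrict (Set.Ioi 0)).prod (volume.restrict (Set.Ioi 0))) := by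
  obtain ⟨c, hc0, hc⟩ := T.exists_norm_resolventCLM_le hM h0
  have hRc := T.continuousOn_resolventCLM_Ioi hM h0
  have hmeas : AEStronglyMeasurable (fun p : ℝ × ℝ => p.2 ^ (-b) • resolventCLM T.generator p.1
      (resolventCLM T.generator (p.2 * p.1 : ℝ) v))
      ((volume.restrict (Set.Ioi 0)).prod (volume.restrict (Set.Ioi 0))) := by
    rw [Measure.prod_restrict]
    refine ContinuousOn.aestronglyMeasurable ?_ (measurableSet_Ioi.prod measurableSet_Ioi)
    have h1 : ContinuousOn (fun p : ℝ × ℝ => p.2 ^ (-b)) (Set.Ioi 0 ×ˢ Set.Ioi 0) := fun p hp =>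
      ((Real.continuousAt_rpow_const p.2 (-b) (Or.inl (ne_of_gt hp.2))).comp
        continuousAt_snd).continuousWithinAt
    have h2 : ContinuousOn (fun p : ℝ × ℝ => resolventCLM T.generator p.1)
        (Set.Ioi 0 ×ˢ Set.Ioi 0) := hRc.comp continuousOn_fst fun p hp => hp.1
    have h3 : ContinuousOn (fun p : ℝ × ℝ => resolventCLM T.generator (p.2 * p.1 : ℝ))
        (Set.Ioi 0 ×ˢ Set.Ioi 0) :=
      hRc.comp (f := fun p : ℝ × ℝ => p.2 * p.1) (continuousOn_snd.mul continuousOn_fst)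
        fun p hp => Set.mem_Ioi.2 (mul_pos hp.2 hp.1)
    exact h1.smul (h2.clm_apply (h3.clm_apply continuousOn_const))
  have hint : ∀ s ∈ Set.Ioi (0 : ℝ), ∀ᵐ ρ ∂(volume.restrict (Set.Ioi (0 : ℝ))),
      ‖ρ ^ (-b) • resolventCLM T.generator s (resolventCLM T.generator (ρ * s : ℝ) v)‖ ≤
        c * min 1 s⁻¹ * ‖ρ ^ (-b) • resolventCLM T.generator (ρ * s : ℝ) v‖ := by
    intro s hs
    filter_upwards [ae_restrict_mem measurableSet_Ioi] with ρ hρ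
    rw [norm_smul, norm_smul, mul_left_comm]
    gcongr
    exact ContinuousLinearMap.le_of_opNorm_le _ (hc s hs) _
  have hscale : ∀ s ∈ Set.Ioi (0 : ℝ), ∀ ρ ∈ Set.Ioi (0 : ℝ),
      ‖ρ ^ (-b) • resolventCLM T.generator (ρ * s : ℝ) v‖ =
        s ^ b * ‖(s * ρ) ^ (-b) • resolventCLM T.generator (s * ρ : ℝ) v‖ := by
    intro s hs ρ hρ
    have hs : 0 < s := hs
    have hρ : 0 < ρ := hρ
    rw [norm_smul, norm_smul, ← mul_assoc, mul_comm ρ s, Real.mul_rpow hs.le hρ.le, norm_mul,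
      ← mul_assoc, Real.norm_of_nonneg (by positivity : (0 : ℝ) ≤ s ^ (-b)),
      ← Real.rpow_add hs, add_neg_cancel, Real.rpow_zero, one_mul]
  set u : ℝ → ℝ := fun r => ‖r ^ (-b) • resolventCLM T.generator r v‖ with hu
  have hui : IntegrableOn u (Set.Ioi 0) :=
    (T.integrableOn_rpow_smul_resolventCLM_apply hM h0 hb hb1 v).norm
  have hui' : ∀ s ∈ Set.Ioi (0 : ℝ), IntegrableOn
      (fun ρ : ℝ => ‖ρ ^ (-b) • resolventCLM T.generator (ρ * s : ℝ) v‖) (Set.Ioi 0) := by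
    intro s hs
    have h1 : IntegrableOn (fun ρ => s ^ b * u (s * ρ)) (Set.Ioi 0) := by
      refine Integrable.const_mul ?_ _
      refine (integrableOn_Ioi_comp_mul_left_iff u 0 hs).2 ?_
      rwa [mul_zero]
    exact h1.congr_fun (fun ρ hρ => (hscale s hs ρ hρ).symm) measurableSet_Ioi
  have hval : ∀ s ∈ Set.Ioi (0 : ℝ),
      ∫ ρ in Set.Ioi (0 : ℝ), ‖ρ ^ (-b) • resolventCLM T.generator (ρ * s : ℝ) v‖ =
        s ^ (b - 1) * ∫ r in Set.Ioi (0 : ℝ), u r := by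
    intro s hs
    rw [setIntegral_congr_fun measurableSet_Ioi (hscale s hs), integral_const_mul,
      integral_comp_mul_left_Ioi u 0 hs, mul_zero, smul_eq_mul, ← mul_assoc,
      Real.rpow_sub_one hs.ne', div_eq_mul_inv]
  refine (integrable_prod_iff hmeas).2 ⟨?_, ?_⟩
  · filter_upwards [ae_restrict_mem measurableSet_Ioi, hmeas.prodMk_left] with s hs hm
    exact Integrable.mono' ((hui' s hs).const_mul (c * min 1 s⁻¹)) hm (hint s hs)
  · have h1 : IntegrableOn (fun s : ℝ => (c * ∫ r in Set.Ioi (0 : ℝ), u r) *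
        (s ^ (b - 1) * (min 1 s⁻¹) ^ (1 : ℝ))) (Set.Ioi 0) :=
      Integrable.const_mul (integrableOn_rpow_mul_min_rpow (by linarith) (by linarith)) _
    refine Integrable.mono' h1 hmeas.norm.integral_prod_right' ?_
    filter_upwards [ae_restrict_mem measurableSet_Ioi] with s hs
    rw [Real.norm_of_nonneg (integral_nonneg fun _ => norm_nonneg _)]
    refine (integral_mono_of_nonneg (Eventually.of_forall fun _ => norm_nonneg _)
      ((hui' s hs).const_mul (c * min 1 s⁻¹)) (hint s hs)).trans (le_of_eq ?_)
    rw [integral_const_mul, hval s hs, Real.rpow_one]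
    ring

/-- Balakrishnan's integral inverts `negPowIntegral` up to a positive constant. -/
theorem exists_integral_resolventCLM_negPowIntegral :
    ∃ κ : ℝ, 0 < κ ∧ ∀ x : T.generator.domain,
      IntegrableOn (fun s : ℝ => s ^ (b - 1) •
        resolventCLM T.generator s (T.negPowIntegral b (shift T.generator 0 x))) (Set.Ioi 0) ∧
      ∫ s in Set.Ioi (0 : ℝ), s ^ (b - 1) •
        resolventCLM T.generator s (T.negPowIntegral b (shift T.generator 0 x)) = κ • (x : X) := by
  have hint : ∀ y : X, IntegrableOn (fun s : ℝ => s ^ (b - 1) •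
      resolventCLM T.generator s y) (Set.Ioi 0) := by
    intro y
    have := T.integrableOn_rpow_smul_resolventCLM_apply hM h0 (b := 1 - b) (by linarith)
      (by linarith) y
    simpa using this
  set k : ℝ → ℝ := fun ρ => ρ ^ (-b) * (Real.log ρ / (ρ - 1)) with hk
  have hk0 : ∀ ρ ∈ Set.Ioi (0 : ℝ), 0 ≤ k ρ := by
    intro ρ hρ
    have hρ : 0 < ρ := hρ
    refine mul_nonneg (by positivity) ?_
    rcases le_total ρ 1 with h | h
    · exact div_nonneg_of_nonpos (Real.log_nonpos hρ.le h) (by linarith)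
    · exact div_nonneg (Real.log_nonneg h) (by linarith)
  have hinner : ∀ x : T.generator.domain, ∀ᵐ ρ ∂(volume.restrict (Set.Ioi (0 : ℝ))),
      ∫ s in Set.Ioi (0 : ℝ), ρ ^ (-b) • resolventCLM T.generator s
        (resolventCLM T.generator (ρ * s : ℝ) (shift T.generator 0 x)) = k ρ • (x : X) := by
    intro x
    have hne : ∀ᵐ ρ ∂(volume.restrict (Set.Ioi (0 : ℝ))), ρ ≠ 1 := by
      refine ae_restrict_of_ae ?_
      simp [ae_iff]
    filter_upwards [ae_restrict_mem measurableSet_Ioi, hne,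
      (T.integrable_resolventCLM_prod hM h0 hb hb1 (shift T.generator 0 x)).prod_left_ae]
      with ρ hρ hρ1 hi
    have hρ : 0 < ρ := hρ
    have hi' : IntegrableOn (fun s : ℝ => resolventCLM T.generator s
        (resolventCLM T.generator (ρ * s : ℝ) (shift T.generator 0 x))) (Set.Ioi 0) := by
      have h1 : ρ ^ (-b) ≠ 0 := (by positivity : 0 < ρ ^ (-b)).ne'
      exact (integrable_smul_iff h1 _).1 hi
    rw [integral_smul, T.integral_resolventCLM_resolventCLM hM h0 hρ hρ1 x hi', smul_smul]
  have hmain : ∀ x : T.generator.domain, ∫ s in Set.Ioi (0 : ℝ), s ^ (b - 1) •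
        resolventCLM T.generator s (T.negPowIntegral b (shift T.generator 0 x)) =
      (∫ ρ in Set.Ioi (0 : ℝ), k ρ) • (x : X) := by
    intro x
    set v := shift T.generator 0 x
    have h1 : ∀ s ∈ Set.Ioi (0 : ℝ), s ^ (b - 1) •
        resolventCLM T.generator s (T.negPowIntegral b v) =
        ∫ ρ in Set.Ioi (0 : ℝ), ρ ^ (-b) • resolventCLM T.generator s
          (resolventCLM T.generator (ρ * s : ℝ) v) := by
      intro s hs
      have hs' : 0 < s := hs
      rw [T.negPowIntegral_apply hM h0 hb hb1, ← ContinuousLinearMap.integral_comp_comm _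
        (T.integrableOn_rpow_smul_resolventCLM_apply hM h0 hb hb1 v)]
      -- Under `r = s ρ` the powers of `s` cancel: `s^(b - 1) * s * s^(-b) = 1`. Only `ρ^(-b)`
      -- survives, so after exchanging the integrals the inner one is Frullani's.
      have h2 := integral_comp_mul_left_Ioi' (fun r : ℝ => resolventCLM T.generator s
        (r ^ (-b) • resolventCLM T.generator r v)) 0 hs
      rw [mul_zero] at h2
      rw [← h2, smul_smul, ← integral_smul]
      refine setIntegral_congr_fun measurableSet_Ioi fun ρ hρ => ?_
      have hρ : 0 < ρ := hρ
      rw [← Complex.coe_smul ((s * ρ) ^ (-b)), map_smul, Complex.coe_smul, smul_smul,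
        mul_comm s ρ]
      congr 1
      rw [Real.mul_rpow hρ.le hs'.le, mul_comm (ρ ^ (-b)), ← mul_assoc]
      nth_rewrite 2 [← Real.rpow_one s]
      rw [← Real.rpow_add hs', ← Real.rpow_add hs']
      simp
    rw [setIntegral_congr_fun measurableSet_Ioi h1]
    have h3 := integral_integral_swap (f := fun s ρ : ℝ => ρ ^ (-b) • resolventCLM T.generator s
      (resolventCLM T.generator (ρ * s : ℝ) v))
      (T.integrable_resolventCLM_prod hM h0 hb hb1 v)
    rw [h3, integral_congr_ae (hinner x), integral_smul_const]
  -- Integrability of the scalar kernel `k`, needed for positivity of its integral, is read off from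
  -- a nonzero vector of `D(A)`; if there is none, any constant works.
  by_cases hx : ∃ x : T.generator.domain, (x : X) ≠ 0
  · obtain ⟨x, hx⟩ := hx
    refine ⟨∫ ρ in Set.Ioi (0 : ℝ), k ρ, ?_, fun x => ⟨hint _, hmain x⟩⟩
    have hki : IntegrableOn k (Set.Ioi 0) := by
      have h4 := (T.integrable_resolventCLM_prod hM h0 hb hb1
        (shift T.generator 0 x)).integral_prod_right.congr (hinner x)
      exact (integrable_smul_const hx).1 h4
    rw [setIntegral_pos_iff_support_of_nonneg_ae
      ((ae_restrict_mem measurableSet_Ioi).mono hk0) hki]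
    refine lt_of_lt_of_le (b := volume (Set.Ioi (1 : ℝ))) (by simp) (measure_mono ?_)
    intro ρ hρ
    have hρ : 1 < ρ := hρ
    have hρ0 : 0 < ρ := one_pos.trans hρ
    refine ⟨(mul_pos (by positivity) (div_pos (Real.log_pos hρ) (by linarith))).ne', hρ0⟩
  · push Not at hx
    refine ⟨1, one_pos, fun x => ⟨hint _, ?_⟩⟩
    rw [hmain x, hx x, smul_zero, smul_zero]

/-- Decay of `T(t) (-A)⁻¹` implies decay of `T(t) (-A) ^ (-b)`. -/
theorem exists_norm_apply_negPowIntegral_le {c a : ℝ} (ha : 0 < a)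
    (hdec : ∀ t : ℝ≥0, 0 < t → ∀ x, ‖T t (resolventCLM T.generator 0 x)‖ ≤
      c * (t : ℝ) ^ (-a) * ‖x‖) :
    ∃ c' a' : ℝ, 0 < a' ∧ ∀ t : ℝ≥0, 0 < t → ∀ x, ‖T t (T.negPowIntegral b x)‖ ≤
      c' * (t : ℝ) ^ (-a') * ‖x‖ := by
  have hM0 := T.bound_nonneg hM
  obtain ⟨c₁, hc₁, hR⟩ := T.exists_norm_resolventCLM_le hM h0
  -- Interpolation weight: the decay bound in `t` is used with weight `q`, the bound `min 1 s⁻¹`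
  -- with weight `1 - q`. Integrability at infinity needs `b + 1 - q > 1`, hence `q < b`.
  set q : ℝ := b / 2 with hq
  have hq0 : 0 < q := by rw [hq]; linarith
  have hh : IntegrableOn (fun s : ℝ => s ^ (-b) * (min 1 s⁻¹) ^ (1 - q)) (Set.Ioi 0) :=
    integrableOn_rpow_mul_min_rpow (by linarith) (by rw [hq]; linarith)
  set J := ∫ s in Set.Ioi (0 : ℝ), s ^ (-b) * (min 1 s⁻¹) ^ (1 - q) with hJ
  set c₂ := |c| * (1 + M) with hc₂
  have hc₂0 : 0 ≤ c₂ := by positivity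
  set c₃ := M * c₁ with hc₃
  have hc₃0 : 0 ≤ c₃ := mul_nonneg hM0 hc₁
  refine ⟨c₂ ^ q * c₃ ^ (1 - q) * J, a * q, by positivity, fun t ht x => ?_⟩
  have ht : (0 : ℝ) < t := ht
  have hmap := (T t).integral_comp_comm
    (T.integrableOn_rpow_smul_resolventCLM_apply hM h0 hb hb1 x)
  rw [T.negPowIntegral_apply hM h0 hb hb1, ← hmap]
  set L := c₂ ^ q * c₃ ^ (1 - q) * (t : ℝ) ^ (-(a * q)) * ‖x‖ with hL
  have hbound : ∀ s ∈ Set.Ioi (0 : ℝ),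
      ‖T t (s ^ (-b) • resolventCLM T.generator s x)‖ ≤
        L * (s ^ (-b) * (min 1 s⁻¹) ^ (1 - q)) := by
    intro s hs
    have hs : 0 < s := hs
    have hm0 : 0 < min 1 s⁻¹ := lt_min one_pos (inv_pos.2 hs)
    set n := ‖T t (resolventCLM T.generator s x)‖ with hn
    have hn0 : 0 ≤ n := norm_nonneg _
    have h1 : n ≤ c₂ * (t : ℝ) ^ (-a) * ‖x‖ := by
      rw [hn, T.resolventCLM_ofReal_apply hM h0 hs]
      refine (hdec t ht _).trans ?_
      calc c * (t : ℝ) ^ (-a) * _ ≤ |c| * (t : ℝ) ^ (-a) * ((1 + M) * ‖x‖) := by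
            gcongr
            · exact le_abs_self c
            · exact T.norm_sub_smul_resolventCLM_le hM hs x
        _ = _ := by rw [hc₂]; ring
    have h2 : n ≤ c₃ * min 1 s⁻¹ * ‖x‖ := by
      refine ((T t).le_of_opNorm_le (hM t) _).trans ?_
      rw [hc₃, mul_assoc, mul_assoc, ← mul_assoc c₁]
      gcongr
      exact ContinuousLinearMap.le_of_opNorm_le _ (hR s hs) x
    have h3 : n ≤ c₂ ^ q * c₃ ^ (1 - q) * (t : ℝ) ^ (-(a * q)) * ‖x‖ *
        (min 1 s⁻¹) ^ (1 - q) := by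
      have hq1 : 0 ≤ 1 - q := by rw [hq]; linarith
      have h4 : n = n ^ q * n ^ (1 - q) := by
        rw [← Real.rpow_add_of_nonneg hn0 hq0.le hq1]
        simp
      have h5 : ‖x‖ = ‖x‖ ^ q * ‖x‖ ^ (1 - q) := by
        rw [← Real.rpow_add_of_nonneg (norm_nonneg x) hq0.le hq1]
        simp
      calc n = n ^ q * n ^ (1 - q) := h4
        _ ≤ (c₂ * (t : ℝ) ^ (-a) * ‖x‖) ^ q * (c₃ * min 1 s⁻¹ * ‖x‖) ^ (1 - q) := by
            gcongr
        _ = c₂ ^ q * c₃ ^ (1 - q) * (t : ℝ) ^ (-(a * q)) * (‖x‖ ^ q * ‖x‖ ^ (1 - q)) *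
            (min 1 s⁻¹) ^ (1 - q) := by
            rw [Real.mul_rpow (by positivity) (norm_nonneg x), Real.mul_rpow hc₂0 (by positivity),
              Real.mul_rpow (by positivity) (norm_nonneg x), Real.mul_rpow hc₃0 hm0.le,
              ← Real.rpow_mul ht.le, neg_mul]
            ring
        _ = _ := by rw [← h5]
    rw [← Complex.coe_smul, map_smul, Complex.coe_smul, norm_smul,
      Real.norm_of_nonneg (by positivity), mul_left_comm]
    gcongr
  calc ‖∫ s in Set.Ioi (0 : ℝ), T t (s ^ (-b) • resolventCLM T.generator s x)‖
      ≤ ∫ s in Set.Ioi (0 : ℝ), L * (s ^ (-b) * (min 1 s⁻¹) ^ (1 - q)) :=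
        norm_integral_le_of_norm_le (hh.const_mul L)
          ((ae_restrict_mem measurableSet_Ioi).mono hbound)
    _ = _ := by
        rw [integral_const_mul, ← hJ, hL]
        ring

end C0Semigroup

end SemigroupTheory
-- A decaying right inverse of the fractional power.
namespace SemigroupTheory

theorem natComp_apply_eq {E F G : Type*} [AddCommGroup E] [Module ℂ E] [AddCommGroup F]
    [Module ℂ F] [AddCommGroup G] [Module ℂ G] {g : F →ₗ.[ℂ] G} {f : E →ₗ.[ℂ] F} {x : E} {y : F}
    {w : G} (hf : ∃ hx : x ∈ f.domain, f ⟨x, hx⟩ = y) (hg : ∃ hy : y ∈ g.domain, g ⟨y, hy⟩ = w) :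
    ∃ hx : x ∈ (natComp g f).domain, natComp g f ⟨x, hx⟩ = w := by
  obtain ⟨hx, rfl⟩ := hf
  obtain ⟨hy, rfl⟩ := hg
  exact ⟨(mem_natComp_domain g f x).2 ⟨hx, hy⟩, natComp_apply g f ⟨x, _⟩ hx hy⟩

section FractionalPower

variable {X : Type*} [NormedAddCommGroup X] [NormedSpace ℂ X] {A : X →ₗ.[ℂ] X}

theorem neg_apply_resolventCLM_zero (h0 : (0 : ℂ) ∈ opResolventSet A) (x : X) :
    ∃ hx : resolventCLM A 0 x ∈ (-A).domain, (-A) ⟨resolventCLM A 0 x, hx⟩ = x := by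
  refine ⟨(opResolvent A 0 x).2, ?_⟩
  have h := apply_opResolvent h0 x
  rw [zero_smul, zero_sub] at h
  rw [LinearPMap.neg_apply]
  exact neg_eq_iff_eq_neg.2 h

theorem opPow_neg_apply_pow (h0 : (0 : ℂ) ∈ opResolventSet A) (k : ℕ) (x : X) :
    ∃ hx : (resolventCLM A 0 ^ k) x ∈ (opPow (-A) k).domain,
      opPow (-A) k ⟨(resolventCLM A 0 ^ k) x, hx⟩ = x := by
  induction k generalizing x with
  | zero => exact ⟨trivial, rfl⟩
  | succ k ih =>
    rw [pow_succ, mul_apply_eq_comp]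
    exact natComp_apply_eq (ih (resolventCLM A 0 x)) (neg_apply_resolventCLM_zero h0 x)

end FractionalPower

namespace C0Semigroup

variable {X : Type*} [NormedAddCommGroup X] [NormedSpace ℂ X] [CompleteSpace X]
  (T : C0Semigroup X) {M : ℝ} (hM : ∀ t, ‖T t‖ ≤ M)
  (h0 : (0 : ℂ) ∈ opResolventSet T.generator)

include h0 in
omit [CompleteSpace X] in
theorem pow_resolventCLM_comm (k : ℕ) (t : ℝ≥0) (x : X) :
    (resolventCLM T.generator 0 ^ k) (T t x) = T t ((resolventCLM T.generator 0 ^ k) x) := by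
  have h : Commute (resolventCLM T.generator 0) (T t) :=
    ContinuousLinearMap.ext fun x => (T.resolventCLM_apply_comm h0 t x).symm
  exact congrArg (fun S : X →L[ℂ] X => S x) (h.pow_left k).eq

include h0 in
omit [CompleteSpace X] in
theorem pow_resolventCLM_mem_domain (k : ℕ) (x : T.generator.domain) :
    (resolventCLM T.generator 0 ^ k) x ∈ T.generator.domain :=
  (T.exists_of_mem_graph
    (T.map_mem_graph (T.pow_resolventCLM_comm h0 k) (T.mem_graph_coe x))).1

include hM h0

/-- `negPowIntegral` is, up to a positive constant, a right inverse of Balakrishnan's operator. -/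
theorem exists_balakrishnan_negPowIntegral {b : ℝ} (hb : 0 < b) (hb1 : b < 1) :
    ∃ κ : ℝ, 0 < κ ∧ ∀ x : T.generator.domain,
      ∃ hx : T.negPowIntegral b x ∈ (balakrishnan T.generator b).domain,
        balakrishnan T.generator b ⟨T.negPowIntegral b x, hx⟩ = κ • (x : X) := by
  obtain ⟨κ, hκ, h⟩ := T.exists_integral_resolventCLM_negPowIntegral hM h0 hb hb1
  refine ⟨Real.sin (Real.pi * b) / Real.pi * κ, ?_, fun x => ?_⟩
  · have : 0 < Real.sin (Real.pi * b) :=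
      Real.sin_pos_of_pos_of_lt_pi (mul_pos Real.pi_pos hb)
        (mul_lt_of_lt_one_right Real.pi_pos hb1)
    positivity
  · have hcomm : ∀ t y, T.negPowIntegral b (T t y) = T t (T.negPowIntegral b y) := fun t y =>
      (T.map_negPowIntegral hM h0 hb hb1 (T.apply_comm t) y).symm
    obtain ⟨hy, hy'⟩ := T.exists_of_mem_graph (T.map_mem_graph hcomm (T.mem_graph_coe x))
    have hI : balakrishnanIntegrand T.generator b ⟨T.negPowIntegral b x, hy⟩ =
        fun s : ℝ => s ^ (b - 1) • resolventCLM T.generator s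
          (T.negPowIntegral b (shift T.generator 0 x)) := by
      funext s
      rw [balakrishnanIntegrand, coe_opResolvent, hy', shift_apply, zero_smul, zero_sub, map_neg,
        map_neg, map_neg]
    obtain ⟨h1, h2⟩ := h x
    rw [← hI] at h1 h2
    refine ⟨⟨hy, h1⟩, ?_⟩
    rw [mul_smul, ← h2]
    rfl

/-- A bounded right inverse of the fractional power `(-A) ^ r` whose composition with `T(t)`
decays. -/
theorem exists_right_inverse_negFracPow {c a r : ℝ} (ha : 0 < a) (hr : 0 < r)
    (hdec : ∀ t : ℝ≥0, 0 < t → ∀ x, ‖T t (resolventCLM T.generator 0 x)‖ ≤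
      c * (t : ℝ) ^ (-a) * ‖x‖) :
    ∃ G : X →L[ℂ] X, (∀ t x, G (T t x) = T t (G x)) ∧
      (∃ c' a' : ℝ, 0 < a' ∧ ∀ t : ℝ≥0, 0 < t → ∀ x, ‖T t (G x)‖ ≤
        c' * (t : ℝ) ^ (-a') * ‖x‖) ∧
      ∀ x : T.generator.domain, ∃ hx : G x ∈ (negFracPow T.generator r).domain,
        negFracPow T.generator r ⟨G x, hx⟩ = x := by
  set k := ⌊r⌋₊ with hk
  set P := resolventCLM T.generator 0 ^ k with hP
  have hPT := T.pow_resolventCLM_comm h0 k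
  by_cases hb : Int.fract r = 0
  -- A positive integer exponent leaves at least one factor `R(0)` to absorb `T(t)` and supply the
  -- decay.
  · have hk0 : k ≠ 0 := by
      intro hk0
      have h1 : ((⌊r⌋₊ : ℕ) : ℝ) = ⌊r⌋ := natCast_floor_eq_intCast_floor hr.le
      have h2 := Int.floor_add_fract r
      rw [hb, ← h1, ← hk, hk0] at h2
      simp at h2
      exact hr.ne h2
    obtain ⟨j, hj⟩ := Nat.exists_eq_succ_of_ne_zero hk0
    refine ⟨P, hPT, ⟨‖resolventCLM T.generator 0 ^ j‖ * c, a, ha, fun t ht x => ?_⟩, fun x => ?_⟩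
    · rw [hP, hj, pow_succ, mul_apply_eq_comp, ← T.pow_resolventCLM_comm h0]
      refine (ContinuousLinearMap.le_opNorm _ _).trans ?_
      rw [mul_assoc, mul_assoc, ← mul_assoc c]
      gcongr
      exact hdec t ht x
    · rw [negFracPow, if_pos hb]
      exact natComp_apply_eq ⟨trivial, rfl⟩ (opPow_neg_apply_pow h0 k x)
  · have hb0 : 0 < Int.fract r := (Int.fract_nonneg r).lt_of_ne' hb
    have hb1 := Int.fract_lt_one r
    set b := Int.fract r with hbr
    obtain ⟨κ, hκ, h⟩ := T.exists_balakrishnan_negPowIntegral hM h0 hb0 hb1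
    obtain ⟨c', a', ha', hdec'⟩ := T.exists_norm_apply_negPowIntegral_le hM h0 hb0 hb1 ha hdec
    set Q := T.negPowIntegral b with hQ
    have hQT : ∀ t y, Q (T t y) = T t (Q y) := fun t y =>
      (T.map_negPowIntegral hM h0 hb0 hb1 (T.apply_comm t) y).symm
    have hPQT : ∀ t y, P (Q (T t y)) = T t (P (Q y)) := fun t y => by rw [hQT, hPT]
    have hPQ : ∀ y, P (Q y) = Q (P y) := fun y =>
      T.map_negPowIntegral hM h0 hb0 hb1 hPT y
    refine ⟨((κ⁻¹ : ℝ) : ℂ) • P.comp Q, fun t x => ?_, ⟨κ⁻¹ * (‖P‖ * c'), a', ha',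
      fun t ht x => ?_⟩, fun x => ?_⟩
    · simp only [_root_.smul_apply, ContinuousLinearMap.comp_apply, hPQT, map_smul]
    · simp only [_root_.smul_apply, ContinuousLinearMap.comp_apply, map_smul, norm_smul]
      rw [Complex.norm_real, Real.norm_of_nonneg (inv_nonneg.2 hκ.le), ← hPT, mul_assoc, mul_assoc]
      refine mul_le_mul_of_nonneg_left ?_ (inv_nonneg.2 hκ.le)
      refine (P.le_opNorm _).trans ?_
      rw [mul_assoc, ← mul_assoc c']
      gcongr
      exact hdec' t ht x
    · have h1 : (((κ⁻¹ : ℝ) : ℂ) • P.comp Q) x = Q (P (((κ⁻¹ : ℝ) : ℂ) • x)) := by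
        simp [hPQ]
      rw [h1, negFracPow, if_neg hb]
      refine natComp_apply_eq (y := P x) ?_ (opPow_neg_apply_pow h0 k x)
      obtain ⟨h2, h3⟩ := h ⟨_, T.pow_resolventCLM_mem_domain h0 k (((κ⁻¹ : ℝ) : ℂ) • x)⟩
      -- The vector already lies in the domain before closure, so closability plays no role.
      have hle := (balakrishnan T.generator b).le_closure
      refine ⟨hle.1 h2, ?_⟩
      rw [← hle.2 (x := ⟨_, h2⟩) rfl, h3, ← Complex.coe_smul]
      simp only [Submodule.coe_smul, map_smul, smul_smul, ← Complex.ofReal_mul]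
      rw [mul_inv_cancel₀ hκ.ne']
      simp [hP]

end C0Semigroup

end SemigroupTheory
-- Polynomial decay and the dyadic covering.
namespace SemigroupTheory

namespace C0Semigroup

section

variable {X : Type*} [NormedAddCommGroup X] [NormedSpace ℂ X] [CompleteSpace X]
  {T : C0Semigroup X}

/-- A polynomially stable semigroup has an invertible generator, and `T(t) A⁻¹` decays at a
polynomial rate, uniformly for `t > 0`. -/
theorem PolynomiallyStable.exists_decay (hT : T.PolynomiallyStable) :
    (0 : ℂ) ∈ opResolventSet T.generator ∧ ∃ c a : ℝ, 0 < a ∧ ∀ t : ℝ≥0, 0 < t → ∀ x,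
      ‖T t (resolventCLM T.generator 0 x)‖ ≤ c * (t : ℝ) ^ (-a) * ‖x‖ := by
  obtain ⟨⟨M, hM⟩, α, hα, hO⟩ := hT
  have hM0 := T.bound_nonneg hM
  have ha : 0 < 1 / α := by positivity
  have h1 : (1 : ℂ) ∈ opResolventSet T.generator := T.mem_resolventSet_of_re_pos hM (by simp)
  have hto : Tendsto (fun t : ℝ≥0 => (t : ℝ) ^ (-1 / α)) atTop (𝓝 0) := by
    rw [neg_div]
    exact (tendsto_rpow_neg_atTop ha).comp (NNReal.tendsto_coe_atTop.2 tendsto_id)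
  have h0 : (0 : ℂ) ∈ opResolventSet T.generator := by
    obtain ⟨t, ht⟩ := ((hO.trans_tendsto hto).eventually_lt_const one_pos).exists
    exact T.zero_mem_resolventSet hM ht
  refine ⟨h0, ?_⟩
  obtain ⟨c, hc0, hc⟩ := hO.exists_pos
  obtain ⟨t₀, ht₀⟩ := eventually_atTop.1 hc.bound
  set S := resolventCLM T.generator 0 with hS
  set R := resolventCLM T.generator 1 with hR
  -- On `(0, τ]` the power `t^(-1/α)` is at least `τ^(-1/α)`, so boundedness of the semigroup
  -- suffices there; adding `1` keeps `τ` positive.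
  set τ : ℝ := t₀ + 1 with hτ
  have hτ0 : 0 < τ := by positivity
  have hR' : ∀ t : ℝ≥0, 0 < t → ‖(T t).comp R‖ ≤
      max c (M * ‖R‖ * τ ^ (1 / α)) * (t : ℝ) ^ (-(1 / α)) := by
    intro t ht
    have ht : (0 : ℝ) < t := ht
    rcases le_total t₀ t with h | h
    · have h2 := ht₀ t h
      rw [norm_norm, neg_div, Real.norm_of_nonneg (by positivity)] at h2
      exact h2.trans (by gcongr; exact le_max_left _ _)
    · have h2 : ‖(T t).comp R‖ ≤ M * ‖R‖ :=
        (ContinuousLinearMap.opNorm_comp_le _ _).trans (by gcongr; exact hM t)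
      have h3 : (t : ℝ) ≤ τ := by
        have : (t : ℝ) ≤ t₀ := h
        linarith
      have h4 : 1 ≤ τ ^ (1 / α) * (t : ℝ) ^ (-(1 / α)) := by
        rw [Real.rpow_neg ht.le, ← div_eq_mul_inv, one_le_div (by positivity)]
        gcongr
      calc ‖(T t).comp R‖ ≤ M * ‖R‖ * (τ ^ (1 / α) * (t : ℝ) ^ (-(1 / α))) :=
            h2.trans (le_mul_of_one_le_right (by positivity) h4)
        _ = (M * ‖R‖ * τ ^ (1 / α)) * (t : ℝ) ^ (-(1 / α)) := by ring
        _ ≤ _ := by gcongr; exact le_max_right _ _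
  refine ⟨max c (M * ‖R‖ * τ ^ (1 / α)) * (1 + ‖S‖), 1 / α, ha, fun t ht x => ?_⟩
  -- The resolvent identity in the form `R(0) = R(1) (I + R(0))` transfers the decay from `1` to
  -- `0`.
  have h2 : S x = R (x + S x) := by
    have := resolventCLM_sub_resolventCLM h1 h0 x
    rw [zero_sub, neg_smul, one_smul] at this
    rw [_root_.map_add, hR, hS, ← sub_eq_iff_eq_add', ← neg_sub, this, neg_neg]
  rw [h2]
  calc ‖(T t).comp R (x + S x)‖ ≤ ‖(T t).comp R‖ * ‖x + S x‖ := ContinuousLinearMap.le_opNorm _ _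
    _ ≤ (max c (M * ‖R‖ * τ ^ (1 / α)) * (t : ℝ) ^ (-(1 / α))) * (‖x‖ + ‖S‖ * ‖x‖) := by
        refine mul_le_mul (hR' t ht) ((norm_add_le _ _).trans ?_) (norm_nonneg _) ?_
        · gcongr
          exact S.le_opNorm x
        · exact (norm_nonneg _).trans (hR' t ht)
    _ = _ := by ring

end

theorem onDomain_add {X : Type*} [NormedAddCommGroup X] [NormedSpace ℂ X] (T : C0Semigroup X)
    (s t : ℝ≥0) (x : T.generator.domain) :
    T.onDomain (s + t) x = T.onDomain s (T.onDomain t x) :=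
  Subtype.ext (T.apply_add s t x)

end C0Semigroup

theorem Ioi_subset_Ioo_union_iUnion_dyadic {t₁ : ℝ} (ht₁ : 0 < t₁) :
    Set.Ioi (0 : ℝ) ⊆ Set.Ioo 0 t₁ ∪
      ⋃ n : ℕ, Set.Ioc (2 * (2 ^ n * (t₁ / 3))) (4 * (2 ^ n * (t₁ / 3))) := by
  intro t ht
  have ht : 0 < t := ht
  rcases lt_or_ge t t₁ with h | h
  · exact Or.inl ⟨ht, h⟩
  · refine Or.inr (Set.mem_iUnion.2 ?_)
    have h1 : 1 ≤ t / t₁ := (one_le_div ht₁).2 h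
    obtain ⟨n, hn1, hn2⟩ := exists_nat_pow_near h1 one_lt_two
    rw [le_div_iff₀ ht₁] at hn1
    rw [div_lt_iff₀ ht₁, pow_succ] at hn2
    have h2 : 0 < 2 ^ n * t₁ := by positivity
    -- From `2^n t₁ ≤ t < 2^(n+1) t₁`, the point lies in block `n` or block `n + 1`, which meet at
    -- `(4/3) 2^n t₁`.
    rcases le_or_gt t (4 * (2 ^ n * (t₁ / 3))) with h3 | h3
    · exact ⟨n, by linarith, h3⟩
    · refine ⟨n + 1, ?_, ?_⟩
      · rw [pow_succ]
        linarith
      · rw [pow_succ]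
        linarith

end SemigroupTheory

/-! ### Summation of the block energies. -/

theorem mainTheorem6 {X Y : Type*}
    [NormedAddCommGroup X] [InnerProductSpace ℂ X] [CompleteSpace X]
    [NormedAddCommGroup Y] [InnerProductSpace ℂ Y] [CompleteSpace Y]
    (T : SemigroupTheory.C0Semigroup X) (hT : T.PolynomiallyStable)
    (C : T.generator.domain →ₗ[ℂ] Y) (hC : SemigroupTheory.IsGraphBounded T.generator C)
    (hfin : SemigroupTheory.FiniteTimeAdmissible T C)
    (hweiss : SemigroupTheory.StrongWeissCondition T.generator C) :
    SemigroupTheory.InfiniteTimeAdmissible T C := by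
  obtain ⟨M, hM⟩ := hT.1
  obtain ⟨h0, c, a, ha, hdec⟩ := hT.exists_decay
  obtain ⟨r, hr, C', hC'b, hC', hW⟩ := hweiss
  obtain ⟨G, hGT, ⟨c', a', ha', hGdec⟩, hG⟩ := T.exists_right_inverse_negFracPow hM h0 ha hr hdec
  obtain ⟨N, hN0, hN⟩ := T.exists_lintegral_output_le hM hC'b hW
  obtain ⟨M₁, t₁, hM₁, ht₁, hfin⟩ := hfin
  -- As `(-A)^r G x = x ∈ D(A)`, the vector `G x` lies in the natural domain of `C (-A)^r`, where
  -- `C'` agrees with it.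
  have hCG : ∀ x : T.generator.domain,
      ∃ hx : G x ∈ T.generator.domain, C' ⟨G x, hx⟩ = C x := by
    intro x
    obtain ⟨h1, h2⟩ := SemigroupTheory.natComp_apply_eq (g := ⟨T.generator.domain, C⟩) (hG x) ⟨x.2, rfl⟩
    exact ⟨hC'.1 h1, (hC'.2 (x := ⟨G x, h1⟩) (y := ⟨G x, hC'.1 h1⟩) rfl).symm.trans h2⟩
  -- With `t₁ / 3` the first block starts at `2 t₁ / 3 < t₁`, so the half-open blocks overlap `(0,
  -- t₁)` and miss no endpoint; doubling makes consecutive blocks `(2τ, 4τ]` adjacent.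
  set τ : ℕ → ℝ := fun n => 2 ^ n * (t₁ / 3) with hτ
  have hτ0 : ∀ n, 0 < τ n := fun n => by positivity
  -- Each doubling of `τ` multiplies the energy bound, proportional to `τ^(-2a')`, by this ratio.
  set q : ℝ := ((2 : ℝ) ^ (-a')) ^ 2 with hq
  have hq1 : q < 1 := by
    have : (2 : ℝ) ^ (-a') < 1 := Real.rpow_lt_one_of_one_lt_of_neg one_lt_two (by linarith)
    exact pow_lt_one₀ (by positivity) this two_ne_zero
  have hq0 : 0 ≤ q := by positivity
  set L : ℝ := N * (c' * (t₁ / 3) ^ (-a')) ^ 2 with hL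
  have hL0 : 0 ≤ L := by positivity
  have hblock : ∀ (x : T.generator.domain) (n : ℕ),
      ∫⁻ t in Set.Ioc (2 * τ n) (4 * τ n), ‖C (T.onDomain t.toNNReal x)‖ₑ ^ 2 ≤
        ENNReal.ofReal (L * ‖(x : X)‖ ^ 2 * q ^ n) := by
    intro x n
    obtain ⟨hGx, -⟩ := hCG x
    set s : ℝ≥0 := (τ n).toNNReal with hs
    have hs' : (s : ℝ) = τ n := Real.coe_toNNReal _ (hτ0 n).le
    have h1 := hN (T.onDomain s ⟨G x, hGx⟩) (τ n) (hτ0 n)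
    have h2 : ∫⁻ t in Set.Ioc (2 * τ n) (4 * τ n), ‖C (T.onDomain t.toNNReal x)‖ₑ ^ 2 =
        ∫⁻ t in Set.Ioc (τ n) (3 * τ n),
          ‖C' (T.onDomain t.toNNReal (T.onDomain s ⟨G x, hGx⟩))‖ₑ ^ 2 := by
      have h3 := (measurePreserving_add_right volume (τ n)).setLIntegral_comp_preimage_emb
        (measurableEmbedding_addRight (τ n))
        (fun t : ℝ => ‖C (T.onDomain t.toNNReal x)‖ₑ ^ 2) (Set.Ioc (2 * τ n) (4 * τ n))
      have h4 : (fun t => t + τ n) ⁻¹' Set.Ioc (2 * τ n) (4 * τ n) =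
          Set.Ioc (τ n) (3 * τ n) := by
        rw [Set.preimage_add_const_Ioc]
        congr 1 <;> ring
      rw [← h3, h4]
      refine setLIntegral_congr_fun measurableSet_Ioc fun t ht => ?_
      have ht0 : 0 ≤ t := ((hτ0 n).trans ht.1).le
      -- After the shift by `τ n`, `C T(t + τ n) x = C' G T(t + τ n) x = C' T(t) T(τ n) G x`,
      -- because `G` commutes with the semigroup.
      obtain ⟨h5, h6⟩ := hCG (T.onDomain (t + τ n).toNNReal x)
      rw [← h6, ← T.onDomain_add, hs, ← Real.toNNReal_add ht0 (hτ0 n).le]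
      congr 4
      exact hGT _ _
    rw [h2]
    refine h1.trans (ENNReal.ofReal_le_ofReal ?_)
    have h7 : ‖((T.onDomain s ⟨G x, hGx⟩ : T.generator.domain) : X)‖ ≤
        c' * (s : ℝ) ^ (-a') * ‖(x : X)‖ := hGdec s (Real.toNNReal_pos.2 (hτ0 n)) x
    calc N * ‖((T.onDomain s ⟨G x, hGx⟩ : T.generator.domain) : X)‖ ^ 2
        ≤ N * (c' * (s : ℝ) ^ (-a') * ‖(x : X)‖) ^ 2 := by gcongr
      _ = L * ‖(x : X)‖ ^ 2 * q ^ n := by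
          rw [hs', hτ]
          simp only
          rw [Real.mul_rpow (by positivity) (by positivity), ← Real.rpow_natCast 2 n,
            ← Real.rpow_mul (by norm_num), mul_comm (n : ℝ), Real.rpow_mul (by norm_num),
            Real.rpow_natCast, hL, hq]
          ring
  refine ⟨M₁ + L * (1 - q)⁻¹, ?_, fun x => ?_⟩
  · have : 0 < 1 - q := by linarith
    positivity
  · have hsum : HasSum (fun n => L * ‖(x : X)‖ ^ 2 * q ^ n) (L * ‖(x : X)‖ ^ 2 * (1 - q)⁻¹) :=
      (hasSum_geometric_of_lt_one hq0 hq1).mul_left _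
    calc ∫⁻ t in Set.Ioi (0 : ℝ), ‖C (T.onDomain t.toNNReal x)‖ₑ ^ 2
        ≤ ∫⁻ t in Set.Ioo 0 t₁ ∪ ⋃ n : ℕ, Set.Ioc (2 * τ n) (4 * τ n),
            ‖C (T.onDomain t.toNNReal x)‖ₑ ^ 2 :=
          lintegral_mono_set (SemigroupTheory.Ioi_subset_Ioo_union_iUnion_dyadic ht₁)
      _ ≤ (∫⁻ t in Set.Ioo 0 t₁, ‖C (T.onDomain t.toNNReal x)‖ₑ ^ 2) +
            ∫⁻ t in ⋃ n : ℕ, Set.Ioc (2 * τ n) (4 * τ n),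
              ‖C (T.onDomain t.toNNReal x)‖ₑ ^ 2 := lintegral_union_le _ _ _
      _ ≤ ENNReal.ofReal (M₁ * ‖(x : X)‖ ^ 2) +
            ∑' n : ℕ, ENNReal.ofReal (L * ‖(x : X)‖ ^ 2 * q ^ n) := by
          gcongr
          · exact hfin x
          · exact (lintegral_iUnion_le _ _).trans (ENNReal.tsum_le_tsum (hblock x))
      _ = ENNReal.ofReal ((M₁ + L * (1 - q)⁻¹) * ‖(x : X)‖ ^ 2) := by
          rw [← ENNReal.ofReal_tsum_of_nonneg (fun n => by positivity) hsum.summable,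
            hsum.tsum_eq, ← ENNReal.ofReal_add (by positivity)]
          · ring_nf
          · exact hsum.nonneg fun n => by positivity
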